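/- **Theorem (Poincaré–Birkhoff–Witt theorem for twisted symplectic reflection algebras).** Let $(U,\omega)$ be a complex symplectic vector space, let $G$ be a finite group acting linearly on $U$ and preserving $\omega$, and let $\psi:G\times G\to\mathbb C^*$ be a $2$-cocycle. Let $\mathbb C_\psi G$ be the twisted group algebra, with basis $g\in G$ and product $g\circ_\psi h=\psi(g,h)\,gh$, and assume that $\psi$ is a class-function cocycle, i.e. the character $g\mapsto\operatorname{tr}\tau(g)$ of every finite-dimensional representation $\tau$ of $\mathbb C_\psi G$ is invariant under conjugation in $G$. For an algebra $A$ with an action of $G$ by algebra automorphisms, $A\rtimes\mathbb C_\psi G$ denotes $A\otimes\mathbb C_\psi G$ with the product $(a\otimes g)(b\otimes h)=\psi(g,h)\,a\,g(b)\otimes gh$. Let $S_\psi\subset G$ be the set of those $s\in G$ that are $\psi$-regular (i.e. $\psi(s,h)=\psi(h,s)$ for all $h$ in the centralizer of $s$) and act on $U$ as symplectic reflections (i.e. $\operatorname{rank}(\mathrm{Id}-s)=2$). For $s\in S_\psi$ let $\omega_s$ be the skew-symmetric form on $U=\operatorname{Ker}(\mathrm{Id}-s)\oplus\operatorname{Im}(\mathrm{Id}-s)$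 which has $\operatorname{Ker}(\mathrm{Id}-s)$ as its radical and coincides with $\omega$ on $\operatorname{Im}(\mathrm{Id}-s)$. Let $c:S_\psi\to\mathbb C$ be invariant under conjugation by $G$, and let $\mathcal H_c(G,U,\psi)$ be the quotient of $TU\rtimes\mathbb C_\psi G$ ($TU$ the tensor algebra) by the two-sided ideal generated by the elements $$y\otimes x-x\otimes y-\omega(x,y)\cdot 1-\sum_{s\in S_\psi}c(s)\,\omega_s(x,y)\,s,\qquad x,y\in U.$$ Filter $\mathcal H_c(G,U,\psi)$ by placing $\mathbb C_\psi G$ in degree $0$ and $U$ in degree $1$: $F_n$ is the image of the elements of $TU\rtimes\mathbb C_\psi G$ of tensor degree at most $n$, and $\mathbf{gr}\,\mathcal H_c(G,U,\psi)=\bigoplus_{n\ge0}F_n/F_{n-1}$ with $F_{-1}=0$. The images of the elements of $U$ in $F_1/F_0$ commute in $\mathbf{gr}\,\mathcal H_c(G,U,\psi)$, so the natural maps $U\to F_1/F_0$ and $\mathbb C_\psi G\to F_0$ extend to an algebra homomorphism $$\phi:(SU)\rtimes\mathbb C_\psi G\to\mathbf{gr}\,\mathcal H_c(G,U,\psi),$$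 where $SU$ is the symmetric algebra of $U$. Then $\phi$ is an isomorphism of graded algebras: it is bijective, and for every $n\ge 0$ it maps $S^nU\otimes\mathbb C_\psi G$ onto $F_n/F_{n-1}$. -/

import Mathlib

universe u v w

open scoped DirectSum

set_option linter.unusedSectionVars false

noncomputable section

namespace TwistedSRA

/-! ### Two-cocycles and crossed products -/

/-- A `ℂˣ`-valued two-cocycle on `G` (trivial action on `ℂˣ`); it need not be normalized. -/
structure TwoCocycle (G : Type u) [Group G] where
  toFun : G → G → ℂˣ
  cocycle : ∀ g h k : G, toFun g h * toFun (g * h) k = toFun h k * toFun g (h * k)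

instance {G : Type u} [Group G] : CoeFun (TwoCocycle G) (fun _ => G → G → ℂˣ) :=
  ⟨TwoCocycle.toFun⟩

theorem TwoCocycle.one_left {G : Type u} [Group G] (ψ : TwoCocycle G) (g : G) :
    ψ 1 g = ψ 1 1 := by
  have h := ψ.cocycle 1 1 g
  simp only [one_mul] at h
  exact (mul_right_cancel h).symm

theorem TwoCocycle.one_right {G : Type u} [Group G] (ψ : TwoCocycle G) (g : G) :
    ψ g 1 = ψ 1 1 := by
  have h := ψ.cocycle g 1 1
  simp only [mul_one] at h
  exact mul_right_cancel h

/-- For an algebra `A` on which the finite group `G` acts by algebra endomorphisms `α g`, the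
semidirect product `A ⋊ ℂ_ψ G`. Its underlying space is `A ⊗ ℂG`, realised as functions `G → A`:
the function `x` stands for `∑ g, x g ⊗ g`. The product is determined by
`(a ⊗ g) (b ⊗ h) = ψ(g,h) (a · g(b)) ⊗ gh`. -/
def CrossedProduct {G : Type u} [Group G] {A : Type v} [Ring A] [Algebra ℂ A]
    (_α : G →* (A →ₐ[ℂ] A)) (_ψ : TwoCocycle G) : Type (max u v) := G → A

namespace CrossedProduct

variable {G : Type u} [Group G] {A : Type v} [Ring A] [Algebra ℂ A]
  (α : G →* (A →ₐ[ℂ] A)) (ψ : TwoCocycle G)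

instance : AddCommGroup (CrossedProduct α ψ) := inferInstanceAs (AddCommGroup (G → A))

instance : Module ℂ (CrossedProduct α ψ) := inferInstanceAs (Module ℂ (G → A))

variable {α ψ}

@[ext] theorem ext {x y : CrossedProduct α ψ} (h : ∀ g, x g = y g) : x = y := funext h

@[simp] theorem add_apply (x y : CrossedProduct α ψ) (g : G) : (x + y) g = x g + y g := rfl

@[simp] theorem zero_apply (g : G) : (0 : CrossedProduct α ψ) g = 0 := rfl

@[simp] theorem smul_apply (r : ℂ) (x : CrossedProduct α ψ) (g : G) : (r • x) g = r • x g := rfl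

variable (α ψ)

open Classical in
/-- The element `a ⊗ g`. -/
def single (g : G) (a : A) : CrossedProduct α ψ := fun h => if h = g then a else 0

variable {α ψ}

theorem single_apply [DecidableEq G] (g h : G) (a : A) :
    single α ψ g a h = if h = g then a else 0 := by
  unfold single; split_ifs <;> rfl

variable [Fintype G]

instance : Mul (CrossedProduct α ψ) :=
  ⟨fun x y k => ∑ g : G, (ψ g (g⁻¹ * k) : ℂ) • (x g * α g (y (g⁻¹ * k)))⟩

/-- The unit of `ℂ_ψ G` is `ψ(1,1)⁻¹` times the basis element of `1 ∈ G`. -/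
instance : One (CrossedProduct α ψ) :=
  ⟨single α ψ 1 (algebraMap ℂ A ((ψ 1 1)⁻¹ : ℂˣ))⟩

theorem mul_apply (x y : CrossedProduct α ψ) (k : G) :
    (x * y) k = ∑ g : G, (ψ g (g⁻¹ * k) : ℂ) • (x g * α g (y (g⁻¹ * k))) := rfl

theorem one_def :
    (1 : CrossedProduct α ψ) = single α ψ 1 (algebraMap ℂ A ((ψ 1 1)⁻¹ : ℂˣ)) := rfl

theorem mul_assoc' (x y z : CrossedProduct α ψ) : x * y * z = x * (y * z) := by
  ext k
  simp only [mul_apply, Finset.sum_mul, Finset.smul_sum, map_sum, Finset.mul_sum]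
  rw [Finset.sum_comm]
  refine Finset.sum_congr rfl fun h _ => ?_
  refine Fintype.sum_equiv (Equiv.mulLeft h⁻¹) _ _ fun g => ?_
  have e4 : h * (h⁻¹ * g) = g := by group
  have e1 : (h⁻¹ * g)⁻¹ * (h⁻¹ * k) = g⁻¹ * k := by group
  have e2 : ∀ a, α g a = α h (α (h⁻¹ * g) a) := fun a => by
    rw [← AlgHom.mul_apply, ← map_mul α, e4]
  have e3 := ψ.cocycle h (h⁻¹ * g) (g⁻¹ * k)
  have e5 : h⁻¹ * g * (g⁻¹ * k) = h⁻¹ * k := by group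
  rw [e4, e5] at e3
  have e6 : (ψ h (h⁻¹ * g) : ℂ) * ψ g (g⁻¹ * k) = ψ (h⁻¹ * g) (g⁻¹ * k) * ψ h (h⁻¹ * k) := by
    exact_mod_cast e3
  simp only [Equiv.coe_mulLeft, e1, map_smul, map_mul (α h), smul_mul_assoc, mul_smul_comm, smul_smul,
    mul_assoc]
  rw [e2 (z _), mul_comm (ψ g _ : ℂ), e6, mul_comm (ψ h _ : ℂ)]

theorem one_mul' (x : CrossedProduct α ψ) : 1 * x = x := by
  classical
  ext k
  rw [mul_apply, Finset.sum_eq_single 1]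
  · simp only [one_def, single_apply, if_true, inv_one, one_mul, map_one, AlgHom.one_apply,
      ψ.one_left k]
    rw [← Algebra.smul_def, smul_smul]
    simp
  · intro g _ hg
    simp [one_def, single_apply, hg]
  · simp

theorem mul_one' (x : CrossedProduct α ψ) : x * 1 = x := by
  classical
  ext k
  rw [mul_apply, Finset.sum_eq_single k]
  · simp only [one_def, single_apply, inv_mul_cancel, if_true, AlgHom.commutes, ψ.one_right k]
    rw [← Algebra.commutes, ← Algebra.smul_def, smul_smul]
    simp
  · intro g _ hg
    have : ¬ (g⁻¹ * k = 1) := fun h => hg (inv_mul_eq_one.mp h)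
    simp [one_def, single_apply, this]
  · simp

instance : Ring (CrossedProduct α ψ) where
  __ := (inferInstance : AddCommGroup (CrossedProduct α ψ))
  __ := (inferInstance : Mul (CrossedProduct α ψ))
  __ := (inferInstance : One (CrossedProduct α ψ))
  mul_assoc := mul_assoc'
  one_mul := one_mul'
  mul_one := mul_one'
  zero_mul x := by ext k; simp [mul_apply]
  mul_zero x := by ext k; simp [mul_apply]
  left_distrib x y z := by ext k; simp [mul_apply, mul_add, Finset.sum_add_distrib]
  right_distrib x y z := by ext k; simp [mul_apply, add_mul, Finset.sum_add_distrib]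

instance : Algebra ℂ (CrossedProduct α ψ) :=
  Algebra.ofModule
    (fun r x y => by ext k; simp [mul_apply, Finset.smul_sum, smul_smul, mul_comm])
    (fun r x y => by ext k; simp [mul_apply, Finset.smul_sum, smul_smul, mul_comm])

@[simp] theorem sum_apply {ι : Type*} (s : Finset ι) (x : ι → CrossedProduct α ψ) (g : G) :
    (∑ i ∈ s, x i) g = ∑ i ∈ s, x i g :=
  Finset.sum_apply g s x

theorem single_mul_single (g h : G) (a b : A) :
    single α ψ g a * single α ψ h b = single α ψ (g * h) ((ψ g h : ℂ) • (a * α g b)) := by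
  classical
  ext k
  rw [mul_apply, Finset.sum_eq_single g]
  · simp only [single_apply, if_true, inv_mul_eq_iff_eq_mul]
    split_ifs with hk
    · subst hk; simp
    · simp
  · intro g' _ hg
    simp [single_apply, hg]
  · simp

variable (α ψ)

/-- The inclusion `A → A ⋊ ℂ_ψ G`, `a ↦ a ⊗ 1`, where `1` is the unit of `ℂ_ψ G`. -/
def base (a : A) : CrossedProduct α ψ := single α ψ 1 (((ψ 1 1)⁻¹ : ℂˣ) • a)

/-- The element `1 ⊗ g`. -/
def of (g : G) : CrossedProduct α ψ := single α ψ g 1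

/-- The subspace `B ⊗ ℂ_ψ G`, for a subspace `B` of `A`. -/
def coeffIn (B : Submodule ℂ A) : Submodule ℂ (CrossedProduct α ψ) where
  carrier := {x | ∀ g, x g ∈ B}
  add_mem' hx hy g := B.add_mem (hx g) (hy g)
  zero_mem' _ := B.zero_mem
  smul_mem' r _ hx g := B.smul_mem r (hx g)

variable {α ψ}

theorem mem_coeffIn {B : Submodule ℂ A} {x : CrossedProduct α ψ} :
    x ∈ coeffIn α ψ B ↔ ∀ g, x g ∈ B := Iff.rfl

theorem single_mem {B : Submodule ℂ A} (g : G) {a : A} (ha : a ∈ B) :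
    single α ψ g a ∈ coeffIn α ψ B := by
  classical
  intro h
  rw [single_apply]
  split_ifs
  · exact ha
  · exact B.zero_mem

theorem of_mul_of (g h : G) : of α ψ g * of α ψ h = (ψ g h : ℂ) • of α ψ (g * h) := by
  classical
  ext k
  simp only [of, single_mul_single, smul_apply, single_apply]
  split_ifs <;> simp

theorem of_one : of α ψ 1 = (ψ 1 1 : ℂ) • (1 : CrossedProduct α ψ) := by
  classical
  ext k
  simp only [of, one_def, smul_apply, single_apply]
  split_ifs
  · rw [Algebra.smul_def, ← map_mul]; simp
  · simp

theorem of_mul_base (g : G) (a : A) : of α ψ g * base α ψ a = base α ψ (α g a) * of α ψ g := by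
  have h : α g (((ψ 1 1)⁻¹ : ℂˣ) • a) = ((ψ 1 1)⁻¹ : ℂˣ) • α g a :=
    map_smul (α g) (((ψ 1 1)⁻¹ : ℂˣ) : ℂ) a
  rw [of, base, base, single_mul_single, single_mul_single, h]
  simp [ψ.one_left g, ψ.one_right g]

section lift

variable {B : Type w} [Ring B] [Algebra ℂ B]

/-- The algebra homomorphism `a ⊗ g ↦ f a * γ g` out of `A ⋊ ℂ_ψ G`, determined by an algebra
homomorphism on `A` and a compatible projective representation `γ` of `G`. -/
def lift (f : A →ₐ[ℂ] B) (γ : G → B) (h1 : γ 1 = (ψ 1 1 : ℂ) • (1 : B))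
    (hmul : ∀ g h, γ g * γ h = (ψ g h : ℂ) • γ (g * h))
    (hf : ∀ g a, γ g * f a = f (α g a) * γ g) : CrossedProduct α ψ →ₐ[ℂ] B :=
  AlgHom.ofLinearMap
    { toFun := fun x => ∑ g : G, f (x g) * γ g
      map_add' := fun x y => by simp [add_mul, Finset.sum_add_distrib]
      map_smul' := fun r x => by simp [Finset.smul_sum] }
    (by
      classical
      simp only [LinearMap.coe_mk, AddHom.coe_mk]
      rw [Finset.sum_eq_single 1]
      · simp only [one_def, single_apply, if_true, AlgHom.commutes, h1]
        rw [← Algebra.smul_def, smul_smul]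
        simp
      · intro g _ hg
        simp [one_def, single_apply, hg]
      · simp)
    (fun x y => by
      simp only [LinearMap.coe_mk, AddHom.coe_mk, mul_apply, map_sum, Finset.sum_mul,
        Finset.mul_sum]
      rw [Finset.sum_comm]
      conv_rhs => rw [Finset.sum_comm]
      refine Finset.sum_congr rfl fun g _ => ?_
      refine Fintype.sum_equiv (Equiv.mulLeft g⁻¹) _ _ fun k => ?_
      have e : f (x g) * γ g * (f (y (g⁻¹ * k)) * γ (g⁻¹ * k))
          = f (x g) * (γ g * f (y (g⁻¹ * k))) * γ (g⁻¹ * k) := by noncomm_ring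
      simp only [Equiv.coe_mulLeft, e, hf, map_smul, map_mul]
      have e' : f (x g) * (f (α g (y (g⁻¹ * k))) * γ g) * γ (g⁻¹ * k)
          = f (x g) * f (α g (y (g⁻¹ * k))) * (γ g * γ (g⁻¹ * k)) := by noncomm_ring
      rw [e', hmul, mul_inv_cancel_left]
      simp)

theorem lift_single (f : A →ₐ[ℂ] B) (γ : G → B) (h1 : γ 1 = (ψ 1 1 : ℂ) • (1 : B))
    (hmul : ∀ g h, γ g * γ h = (ψ g h : ℂ) • γ (g * h))
    (hf : ∀ g a, γ g * f a = f (α g a) * γ g) (g : G) (a : A) :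
    lift f γ h1 hmul hf (single α ψ g a) = f a * γ g := by
  classical
  change ∑ k : G, f (single α ψ g a k) * γ k = _
  rw [Finset.sum_eq_single g]
  · simp [single_apply]
  · intro k _ hk
    simp [single_apply, hk]
  · simp

end lift

end CrossedProduct

open CrossedProduct

/-! ### Twisted group algebras, regular elements, class-function cocycles -/

section Group

variable {G : Type u} [Group G]

/-- The twisted group algebra `ℂ_ψ G`, with basis `g ∈ G` and product `g · h = ψ(g,h) gh`. -/
abbrev TwistedGroupAlgebra (ψ : TwoCocycle G) : Type u :=
  CrossedProduct (1 : G →* (ℂ →ₐ[ℂ] ℂ)) ψ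

/-- `g` is `ψ`-regular if `ψ(g,h) = ψ(h,g)` for all `h` in the centralizer of `g`. -/
def IsRegular (ψ : TwoCocycle G) (g : G) : Prop :=
  ∀ h ∈ Subgroup.centralizer {g}, ψ g h = ψ h g

/-- `ψ` is a class-function cocycle: the character of every finite-dimensional representation of
`ℂ_ψ G` is invariant under conjugation in `G`. -/
def TwoCocycle.IsClassFunction [Fintype G] (ψ : TwoCocycle G) : Prop :=
  ∀ (V : Type u) [AddCommGroup V] [Module ℂ V] [FiniteDimensional ℂ V]
    (τ : TwistedGroupAlgebra ψ →ₐ[ℂ] Module.End ℂ V) (g h : G),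
    LinearMap.trace ℂ V (τ (of 1 ψ (h * g * h⁻¹))) = LinearMap.trace ℂ V (τ (of 1 ψ g))

end Group

/-! ### The associated graded algebra of a filtered algebra -/

/-- An increasing multiplicative filtration of an algebra, indexed by `ℕ`. -/
structure AlgFiltration (H : Type w) [Ring H] [Algebra ℂ H] where
  F : ℕ → Submodule ℂ H
  mono : Monotone F
  one_mem : 1 ∈ F 0
  mul_mem : ∀ {i j : ℕ} {x y : H}, x ∈ F i → y ∈ F j → x * y ∈ F (i + j)

namespace AlgFiltration

variable {H : Type w} [Ring H] [Algebra ℂ H] (𝓕 : AlgFiltration H)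

/-- `F (n - 1)`, with `F (-1) = 0`. -/
def below : ℕ → Submodule ℂ H
  | 0 => ⊥
  | n + 1 => 𝓕.F n

theorem below_mul {i j : ℕ} {x y : H} (hx : x ∈ 𝓕.below i) (hy : y ∈ 𝓕.F j) :
    x * y ∈ 𝓕.below (i + j) := by
  cases i with
  | zero =>
    have : x = 0 := hx
    simp [this]
  | succ i =>
    rw [show i + 1 + j = (i + j) + 1 by omega]
    exact 𝓕.mul_mem hx hy

theorem mul_below {i j : ℕ} {x y : H} (hx : x ∈ 𝓕.F i) (hy : y ∈ 𝓕.below j) :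
    x * y ∈ 𝓕.below (i + j) := by
  cases j with
  | zero =>
    have : y = 0 := hy
    simp [this]
  | succ j => exact 𝓕.mul_mem hx hy

/-- The graded piece `F n / F (n - 1)`. -/
def Piece (n : ℕ) : Type w := 𝓕.F n ⧸ (𝓕.below n).submoduleOf (𝓕.F n)

instance (n : ℕ) : AddCommGroup (𝓕.Piece n) :=
  inferInstanceAs (AddCommGroup (𝓕.F n ⧸ (𝓕.below n).submoduleOf (𝓕.F n)))

instance (n : ℕ) : Module ℂ (𝓕.Piece n) :=
  inferInstanceAs (Module ℂ (𝓕.F n ⧸ (𝓕.below n).submoduleOf (𝓕.F n)))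

/-- The class in `F n / F (n - 1)` of an element of `F n`. -/
def symb (n : ℕ) (x : H) (hx : x ∈ 𝓕.F n) : 𝓕.Piece n := Submodule.Quotient.mk ⟨x, hx⟩

theorem symb_eq {n : ℕ} {x y : H} (hx : x ∈ 𝓕.F n) (hy : y ∈ 𝓕.F n) :
    𝓕.symb n x hx = 𝓕.symb n y hy ↔ x - y ∈ 𝓕.below n :=
  Submodule.Quotient.eq _

theorem symb_surj {n : ℕ} (a : 𝓕.Piece n) : ∃ x hx, 𝓕.symb n x hx = a := by
  obtain ⟨⟨x, hx⟩, rfl⟩ := Submodule.Quotient.mk_surjective _ a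
  exact ⟨x, hx, rfl⟩

/-- The product `F i / F (i - 1) × F j / F (j - 1) → F (i + j) / F (i + j - 1)` induced by the
product of the filtered algebra. -/
def pieceMul {i j : ℕ} (a : 𝓕.Piece i) (b : 𝓕.Piece j) : 𝓕.Piece (i + j) :=
  Quotient.map₂ (fun (x : 𝓕.F i) (y : 𝓕.F j) =>
      (⟨x.1 * y.1, 𝓕.mul_mem x.2 y.2⟩ : 𝓕.F (i + j)))
    (fun x x' hx y y' hy => by
      have hx' : (x : H) - x' ∈ 𝓕.below i :=
        (Submodule.quotientRel_def ((𝓕.below i).submoduleOf (𝓕.F i))).mp hx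
      have hy' : (y : H) - y' ∈ 𝓕.below j :=
        (Submodule.quotientRel_def ((𝓕.below j).submoduleOf (𝓕.F j))).mp hy
      refine (Submodule.quotientRel_def _).mpr ?_
      change (x : H) * y - x' * y' ∈ 𝓕.below (i + j)
      have e : (x : H) * y - x' * y' = (x - x') * y + x' * (y - y') := by noncomm_ring
      rw [e]
      exact add_mem (𝓕.below_mul hx' y.2) (𝓕.mul_below x'.2 hy')) a b

theorem pieceMul_symb {i j : ℕ} {x y : H} (hx : x ∈ 𝓕.F i) (hy : y ∈ 𝓕.F j) :
    𝓕.pieceMul (𝓕.symb i x hx) (𝓕.symb j y hy) = 𝓕.symb (i + j) (x * y) (𝓕.mul_mem hx hy) := rfl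

theorem symb_add {n : ℕ} {x y : H} (hx : x ∈ 𝓕.F n) (hy : y ∈ 𝓕.F n) :
    𝓕.symb n x hx + 𝓕.symb n y hy = 𝓕.symb n (x + y) (add_mem hx hy) := rfl

theorem symb_smul {n : ℕ} (r : ℂ) {x : H} (hx : x ∈ 𝓕.F n) :
    r • 𝓕.symb n x hx = 𝓕.symb n (r • x) (Submodule.smul_mem _ r hx) := rfl

theorem symb_zero {n : ℕ} : 𝓕.symb n 0 (zero_mem _) = 0 := rfl

theorem mk_symb_eq {i j : ℕ} (hij : i = j) {x y : H} (hx : x ∈ 𝓕.F i) (hy : y ∈ 𝓕.F j)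
    (hxy : x = y) :
    (GradedMonoid.mk i (𝓕.symb i x hx) : GradedMonoid 𝓕.Piece)
      = GradedMonoid.mk j (𝓕.symb j y hy) := by
  subst hij; subst hxy; rfl

instance : GradedMonoid.GOne 𝓕.Piece := ⟨𝓕.symb 0 1 𝓕.one_mem⟩

instance : GradedMonoid.GMul 𝓕.Piece := ⟨𝓕.pieceMul⟩

instance : GradedMonoid.GMonoid 𝓕.Piece where
  one_mul := by
    rintro ⟨i, a⟩
    obtain ⟨x, hx, rfl⟩ := 𝓕.symb_surj a
    exact 𝓕.mk_symb_eq (zero_add i) _ _ (one_mul x)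
  mul_one := by
    rintro ⟨i, a⟩
    obtain ⟨x, hx, rfl⟩ := 𝓕.symb_surj a
    exact 𝓕.mk_symb_eq (add_zero i) _ _ (mul_one x)
  mul_assoc := by
    rintro ⟨i, a⟩ ⟨j, b⟩ ⟨k, c⟩
    obtain ⟨x, hx, rfl⟩ := 𝓕.symb_surj a
    obtain ⟨y, hy, rfl⟩ := 𝓕.symb_surj b
    obtain ⟨z, hz, rfl⟩ := 𝓕.symb_surj c
    exact 𝓕.mk_symb_eq (add_assoc i j k) _ _ (mul_assoc x y z)

theorem gmul_symb {i j : ℕ} {x y : H} (hx : x ∈ 𝓕.F i) (hy : y ∈ 𝓕.F j) :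
    GradedMonoid.GMul.mul (𝓕.symb i x hx) (𝓕.symb j y hy)
      = 𝓕.symb (i + j) (x * y) (𝓕.mul_mem hx hy) := rfl

instance : DirectSum.GRing 𝓕.Piece where
  __ := (inferInstance : GradedMonoid.GMonoid 𝓕.Piece)
  mul_zero {i j} a := by
    obtain ⟨x, hx, rfl⟩ := 𝓕.symb_surj a
    rw [← symb_zero, ← symb_zero, gmul_symb, symb_eq]
    simp
  zero_mul {i j} a := by
    obtain ⟨x, hx, rfl⟩ := 𝓕.symb_surj a
    rw [← symb_zero, ← symb_zero, gmul_symb, symb_eq]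
    simp
  mul_add {i j} a b c := by
    obtain ⟨x, hx, rfl⟩ := 𝓕.symb_surj a
    obtain ⟨y, hy, rfl⟩ := 𝓕.symb_surj b
    obtain ⟨z, hz, rfl⟩ := 𝓕.symb_surj c
    simp only [symb_add, gmul_symb, symb_eq]
    simp [mul_add]
  add_mul {i j} a b c := by
    obtain ⟨x, hx, rfl⟩ := 𝓕.symb_surj a
    obtain ⟨y, hy, rfl⟩ := 𝓕.symb_surj b
    obtain ⟨z, hz, rfl⟩ := 𝓕.symb_surj c
    simp only [symb_add, gmul_symb, symb_eq]
    simp [add_mul]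
  natCast n := n • 𝓕.symb 0 1 𝓕.one_mem
  natCast_zero := zero_smul _ _
  natCast_succ n := succ_nsmul _ n
  intCast n := n • 𝓕.symb 0 1 𝓕.one_mem
  intCast_ofNat n := natCast_zsmul _ n
  intCast_negSucc_ofNat n := negSucc_zsmul _ n

instance : DirectSum.GAlgebra ℂ 𝓕.Piece where
  toFun := ((LinearMap.toSpanSingleton ℂ (𝓕.Piece 0) (𝓕.symb 0 1 𝓕.one_mem) :
    ℂ →ₗ[ℂ] 𝓕.Piece 0) : ℂ →+ 𝓕.Piece 0)
  map_one := (LinearMap.toSpanSingleton_apply ℂ (𝓕.Piece 0) _ _).trans (one_smul ℂ _)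
  map_mul r s := 𝓕.mk_symb_eq (zero_add 0).symm
    (Submodule.smul_mem _ (r * s) 𝓕.one_mem)
    (𝓕.mul_mem (Submodule.smul_mem _ r 𝓕.one_mem) (Submodule.smul_mem _ s 𝓕.one_mem))
    (by simp [smul_smul, mul_comm])
  commutes := by
    rintro r ⟨i, a⟩
    obtain ⟨x, hx, rfl⟩ := 𝓕.symb_surj a
    exact 𝓕.mk_symb_eq (add_comm 0 i)
      (𝓕.mul_mem (Submodule.smul_mem _ r 𝓕.one_mem) hx)
      (𝓕.mul_mem hx (Submodule.smul_mem _ r 𝓕.one_mem)) (by simp)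
  smul_def := by
    rintro r ⟨i, a⟩
    obtain ⟨x, hx, rfl⟩ := 𝓕.symb_surj a
    exact 𝓕.mk_symb_eq (zero_add i).symm (Submodule.smul_mem _ r hx)
      (𝓕.mul_mem (Submodule.smul_mem _ r 𝓕.one_mem) hx) (by simp)

/-- The associated graded algebra `gr H = ⨁ n, F n / F (n - 1)`. -/
abbrev Gr : Type w := ⨁ n, 𝓕.Piece n

/-- The graded piece of degree `n`, as a subspace of `gr H`. -/
def grPart (n : ℕ) : Submodule ℂ 𝓕.Gr := LinearMap.range (DirectSum.lof ℂ ℕ 𝓕.Piece n)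

/-- The class in degree `n` of `gr H` of an element of `F n`. -/
def grMk (n : ℕ) (x : H) (hx : x ∈ 𝓕.F n) : 𝓕.Gr := DirectSum.of 𝓕.Piece n (𝓕.symb n x hx)

theorem grMk_mul {i j : ℕ} {x y : H} (hx : x ∈ 𝓕.F i) (hy : y ∈ 𝓕.F j) :
    𝓕.grMk i x hx * 𝓕.grMk j y hy = 𝓕.grMk (i + j) (x * y) (𝓕.mul_mem hx hy) :=
  DirectSum.of_mul_of _ _

theorem grMk_eq {i j : ℕ} (hij : i = j) {x y : H} (hx : x ∈ 𝓕.F i) (hy : y ∈ 𝓕.F j)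
    (hxy : x - y ∈ 𝓕.below i) : 𝓕.grMk i x hx = 𝓕.grMk j y hy := by
  subst hij
  unfold grMk
  rw [(𝓕.symb_eq hx hy).mpr hxy]

theorem grMk_smul {n : ℕ} (r : ℂ) {x : H} (hx : x ∈ 𝓕.F n) :
    𝓕.grMk n (r • x) (Submodule.smul_mem _ r hx) = r • 𝓕.grMk n x hx := by
  rw [grMk, ← symb_smul]
  exact map_smul (DirectSum.lof ℂ ℕ 𝓕.Piece n) r _

theorem grMk_add {n : ℕ} {x y : H} (hx : x ∈ 𝓕.F n) (hy : y ∈ 𝓕.F n) :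
    𝓕.grMk n (x + y) (add_mem hx hy) = 𝓕.grMk n x hx + 𝓕.grMk n y hy := by
  rw [grMk, ← symb_add]
  exact map_add (DirectSum.of 𝓕.Piece n) _ _

theorem grMk_one : 𝓕.grMk 0 1 𝓕.one_mem = 1 := rfl

end AlgFiltration

/-! ### Twisted symplectic reflection algebras -/

section SRA

variable {G : Type u} [Group G] {U : Type v} [AddCommGroup U] [Module ℂ U]

/-- The action of `G` on the tensor algebra `TU` induced by its action on `U`. -/
def tensorAction (ρ : Representation ℂ G U) :
    G →* (TensorAlgebra ℂ U →ₐ[ℂ] TensorAlgebra ℂ U) where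
  toFun g := TensorAlgebra.lift ℂ (TensorAlgebra.ι ℂ ∘ₗ ρ g)
  map_one' := by ext; simp
  map_mul' g h := by ext; simp

@[simp] theorem tensorAction_ι (ρ : Representation ℂ G U) (g : G) (x : U) :
    tensorAction ρ g (TensorAlgebra.ι ℂ x) = TensorAlgebra.ι ℂ (ρ g x) := by
  simp [tensorAction]

/-- The action of `G` on the symmetric algebra `SU` induced by its action on `U`. -/
def symAction (ρ : Representation ℂ G U) :
    G →* (SymmetricAlgebra ℂ U →ₐ[ℂ] SymmetricAlgebra ℂ U) where
  toFun g := SymmetricAlgebra.lift (SymmetricAlgebra.ι ℂ U ∘ₗ ρ g)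
  map_one' := by ext; simp
  map_mul' g h := by ext; simp

@[simp] theorem symAction_ι (ρ : Representation ℂ G U) (g : G) (x : U) :
    symAction ρ g (SymmetricAlgebra.ι ℂ U x) = SymmetricAlgebra.ι ℂ U (ρ g x) := by
  simp [symAction]

/-- A symplectic reflection of `(U, ω)`: an element `f` of `Sp(U)` with `rank (1 - f) = 2`. -/
def IsSymplecticReflection (ω : LinearMap.BilinForm ℂ U) (f : Module.End ℂ U) : Prop :=
  (∀ x y, ω (f x) (f y) = ω x y) ∧ Module.finrank ℂ (LinearMap.range (1 - f)) = 2

/-- The set `S_ψ(G,U)` of `ψ`-regular elements of `G` acting on `U` by symplectic reflections. -/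
def regularReflections (ρ : Representation ℂ G U) (ω : LinearMap.BilinForm ℂ U)
    (ψ : TwoCocycle G) : Set G :=
  {s | IsSymplecticReflection ω (ρ s) ∧ IsRegular ψ s}

variable [Fintype G]

/-- `U = Im (1 - s) ⊕ Ker (1 - s)`, since `s` acts with finite order. -/
theorem isCompl_range_ker (ρ : Representation ℂ G U) (s : G) :
    IsCompl (LinearMap.range (1 - ρ s)) (LinearMap.ker (1 - ρ s)) := by
  have hn : (orderOf s : ℂ) ≠ 0 := by exact_mod_cast (orderOf_pos s).ne'
  have hpow : ρ s ^ orderOf s = 1 := by rw [← map_pow, pow_orderOf_eq_one, map_one]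
  have hgeom : (∑ i ∈ Finset.range (orderOf s), ρ s ^ i) * (1 - ρ s) = 0 := by
    rw [geom_sum_mul_neg, hpow, sub_self]
  constructor
  · rw [Submodule.disjoint_def]
    rintro y ⟨x, rfl⟩ hy
    set y := (1 - ρ s) x with hyx
    have hy' : ρ s y = y := by
      have : y - ρ s y = 0 := hy
      exact (sub_eq_zero.mp this).symm
    have hpy : ∀ i : ℕ, (ρ s ^ i) y = y := fun i => by
      induction i with
      | zero => simp
      | succ i ih => rw [pow_succ, Module.End.mul_apply, hy', ih]
    have h0 := congrArg (fun f : Module.End ℂ U => f x) hgeom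
    simp only [Module.End.mul_apply, ← hyx, LinearMap.sum_apply, hpy, LinearMap.zero_apply,
      Finset.sum_const, Finset.card_range] at h0
    rw [← Nat.cast_smul_eq_nsmul ℂ] at h0
    exact (smul_eq_zero.mp h0).resolve_left hn
  · rw [codisjoint_iff, eq_top_iff]
    intro x _
    have hgeom' : (1 - ρ s) * (∑ i ∈ Finset.range (orderOf s), ρ s ^ i) = 0 := by
      rw [mul_neg_geom_sum, hpow, sub_self]
    set a : U := (orderOf s : ℂ)⁻¹ • (∑ i ∈ Finset.range (orderOf s), ρ s ^ i) x with ha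
    have hak : a ∈ LinearMap.ker (1 - ρ s) := by
      rw [LinearMap.mem_ker, ha, map_smul, ← Module.End.mul_apply, hgeom']
      simp
    have hxi : ∀ i : ℕ, x - (ρ s ^ i) x ∈ LinearMap.range (1 - ρ s) := fun i =>
      ⟨(∑ j ∈ Finset.range i, ρ s ^ j) x, by
        rw [← Module.End.mul_apply, mul_neg_geom_sum]; simp⟩
    have har : x - a ∈ LinearMap.range (1 - ρ s) := by
      have : x - a = (orderOf s : ℂ)⁻¹ •
          ∑ i ∈ Finset.range (orderOf s), (x - (ρ s ^ i) x) := by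
        rw [Finset.sum_sub_distrib, Finset.sum_const, Finset.card_range, smul_sub,
          ← Nat.cast_smul_eq_nsmul ℂ, smul_smul, inv_mul_cancel₀ hn, one_smul, ha,
          LinearMap.sum_apply]
      rw [this]
      exact Submodule.smul_mem _ _ (Submodule.sum_mem _ fun i _ => hxi i)
    rw [← sub_add_cancel x a]
    exact Submodule.add_mem_sup har hak

/-- The form `ω_s`: it vanishes when one argument lies in `Ker (1 - s)` and coincides with `ω` on
`Im (1 - s)`; that is, `ω_s(x,y) = ω(p x, p y)` with `p` the projection onto `Im (1 - s)` along
`Ker (1 - s)`. -/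
def reflectionForm (ρ : Representation ℂ G U) (ω : LinearMap.BilinForm ℂ U) (s : G) :
    LinearMap.BilinForm ℂ U :=
  ω.compl₁₂ (Submodule.projection _ _ (isCompl_range_ker ρ s))
    (Submodule.projection _ _ (isCompl_range_ker ρ s))

/-- The semidirect product `TU ⋊ ℂ_ψ G`. -/
abbrev TensorCrossed (ρ : Representation ℂ G U) (ψ : TwoCocycle G) : Type (max u v) :=
  CrossedProduct (tensorAction ρ) ψ

/-- The semidirect product `SU ⋊ ℂ_ψ G`. -/
abbrev SymCrossed (ρ : Representation ℂ G U) (ψ : TwoCocycle G) : Type (max u v) :=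
  CrossedProduct (symAction ρ) ψ

variable (ρ : Representation ℂ G U) (ω : LinearMap.BilinForm ℂ U) (ψ : TwoCocycle G)
  (c : regularReflections ρ ω ψ → ℂ)

/-- A vector `x` of `U`, as the element `x ⊗ 1` of `TU ⋊ ℂ_ψ G`. -/
def vec (x : U) : TensorCrossed ρ ψ := base (tensorAction ρ) ψ (TensorAlgebra.ι ℂ x)

/-- A group element, as the element `1 ⊗ g` of `TU ⋊ ℂ_ψ G`. -/
def grp (g : G) : TensorCrossed ρ ψ := of (tensorAction ρ) ψ g

open Classical in
/-- The element `y ⊗ x - x ⊗ y - ω(x,y) · 1 - ∑ s ∈ S_ψ(G,U), c(s) ω_s(x,y) s`. -/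
def relator (x y : U) : TensorCrossed ρ ψ :=
  vec ρ ψ y * vec ρ ψ x - vec ρ ψ x * vec ρ ψ y - ω x y • (1 : TensorCrossed ρ ψ)
    - ∑ s : regularReflections ρ ω ψ, (c s * reflectionForm ρ ω s x y) • grp ρ ψ s

/-- The two-sided ideal generated by the elements `relator x y`, `x, y ∈ U`. -/
def relIdeal : TwoSidedIdeal (TensorCrossed ρ ψ) :=
  TwoSidedIdeal.span (Set.range fun p : U × U => relator ρ ω ψ c p.1 p.2)

/-- The twisted symplectic reflection algebra `H_c(G,U,ψ)`. -/
abbrev SRA : Type (max u v) := (relIdeal ρ ω ψ c).ringCon.Quotient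

/-- The quotient map `TU ⋊ ℂ_ψ G → H_c(G,U,ψ)`. -/
def toSRA : TensorCrossed ρ ψ →ₐ[ℂ] SRA ρ ω ψ c := RingCon.mkₐ ℂ _

theorem toSRA_relator (x y : U) : toSRA ρ ω ψ c (relator ρ ω ψ c x y) = 0 := by
  have h : relator ρ ω ψ c x y ∈ relIdeal ρ ω ψ c := TwoSidedIdeal.subset_span ⟨(x, y), rfl⟩
  exact (RingCon.eq _).mpr h

variable (U) in
/-- The tensors of degree at most `n`, i.e. the span of the products of at most `n` vectors. -/
def tensorLE (n : ℕ) : Submodule ℂ (TensorAlgebra ℂ U) :=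
  (1 ⊔ LinearMap.range (TensorAlgebra.ι ℂ : U →ₗ[ℂ] TensorAlgebra ℂ U)) ^ n

theorem tensorAction_mem {n : ℕ} (g : G) {a : TensorAlgebra ℂ U} (ha : a ∈ tensorLE U n) :
    tensorAction ρ g a ∈ tensorLE U n := by
  have h : (tensorLE U n).map (tensorAction ρ g).toLinearMap ≤ tensorLE U n := by
    unfold tensorLE
    rw [Submodule.map_pow]
    refine pow_le_pow_left' ?_ n
    rw [Submodule.map_sup, Submodule.map_one]
    refine sup_le_sup le_rfl ?_
    rintro _ ⟨_, ⟨x, rfl⟩, rfl⟩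
    exact ⟨ρ g x, by simp⟩
  exact h ⟨a, ha, rfl⟩

/-- The filtration of `H_c(G,U,ψ)` with `ℂ_ψ G` in degree `0` and `U` in degree `1`: its `n`-th
term is the image of the elements of `TU ⋊ ℂ_ψ G` of tensor degree at most `n`. -/
def filtration : AlgFiltration (SRA ρ ω ψ c) where
  F n := (coeffIn (tensorAction ρ) ψ (tensorLE U n)).map (toSRA ρ ω ψ c).toLinearMap
  mono i j hij := by
    refine Submodule.map_mono fun x hx g => ?_
    exact (pow_le_pow_right' le_sup_left hij : tensorLE U i ≤ tensorLE U j) (hx g)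
  one_mem := by
    refine ⟨1, ?_, map_one (toSRA ρ ω ψ c)⟩
    refine single_mem 1 ?_
    simp [tensorLE]
  mul_mem {i j} := by
    rintro _ _ ⟨x, hx, rfl⟩ ⟨y, hy, rfl⟩
    refine ⟨x * y, fun k => ?_, map_mul (toSRA ρ ω ψ c) x y⟩
    rw [mul_apply]
    refine Submodule.sum_mem _ fun g _ => Submodule.smul_mem _ _ ?_
    unfold tensorLE
    rw [pow_add]
    exact Submodule.mul_mem_mul (hx g) (tensorAction_mem ρ g (hy _))

theorem vec_add (x y : U) : vec ρ ψ (x + y) = vec ρ ψ x + vec ρ ψ y := by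
  classical
  ext g
  simp only [vec, base, CrossedProduct.add_apply, single_apply]
  split_ifs <;> simp

theorem vec_smul (r : ℂ) (x : U) : vec ρ ψ (r • x) = r • vec ρ ψ x := by
  classical
  ext g
  simp only [vec, base, CrossedProduct.smul_apply, single_apply]
  split_ifs
  · rw [map_smul, smul_comm]
  · simp

theorem toSRA_mem {n : ℕ} {x : TensorCrossed ρ ψ}
    (hx : x ∈ coeffIn (tensorAction ρ) ψ (tensorLE U n)) :
    toSRA ρ ω ψ c x ∈ (filtration ρ ω ψ c).F n := ⟨x, hx, rfl⟩

theorem vec_mem (x : U) : vec ρ ψ x ∈ coeffIn (tensorAction ρ) ψ (tensorLE U 1) := by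
  refine single_mem 1 ?_
  unfold tensorLE
  rw [pow_one]
  exact Submodule.smul_mem _ (((ψ 1 1)⁻¹ : ℂˣ) : ℂ) (Submodule.mem_sup_right ⟨x, rfl⟩)

theorem grp_mem (g : G) : grp ρ ψ g ∈ coeffIn (tensorAction ρ) ψ (tensorLE U 0) := by
  refine single_mem g ?_
  simp [tensorLE]

/-- The associated graded algebra `gr H_c(G,U,ψ)`. -/
abbrev GrSRA : Type (max u v) := (filtration ρ ω ψ c).Gr

/-- The tautological map `U → gr H_c(G,U,ψ)`, with values in degree `1`. -/
def grVec : U →ₗ[ℂ] GrSRA ρ ω ψ c where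
  toFun x := (filtration ρ ω ψ c).grMk 1 (toSRA ρ ω ψ c (vec ρ ψ x))
    (toSRA_mem ρ ω ψ c (vec_mem ρ ψ x))
  map_add' x y := by
    rw [← AlgFiltration.grMk_add]
    refine AlgFiltration.grMk_eq _ rfl _ _ ?_
    rw [vec_add]
    simp
  map_smul' r x := by
    rw [RingHom.id_apply, ← AlgFiltration.grMk_smul]
    refine AlgFiltration.grMk_eq _ rfl _ _ ?_
    rw [vec_smul]
    simp

/-- The class of `g ∈ G` in degree `0` of `gr H_c(G,U,ψ)`. -/
def grGrp (g : G) : GrSRA ρ ω ψ c :=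
  (filtration ρ ω ψ c).grMk 0 (toSRA ρ ω ψ c (grp ρ ψ g))
    (toSRA_mem ρ ω ψ c (grp_mem ρ ψ g))

theorem grVec_comm (x y : U) :
    grVec ρ ω ψ c x * grVec ρ ω ψ c y = grVec ρ ω ψ c y * grVec ρ ω ψ c x := by
  refine ((filtration ρ ω ψ c).grMk_mul _ _).trans (Eq.trans ?_
    ((filtration ρ ω ψ c).grMk_mul _ _).symm)
  refine AlgFiltration.grMk_eq _ rfl _ _ ?_
  have h := toSRA_relator ρ ω ψ c y x
  simp only [relator, map_sub, map_mul, map_smul, map_one, map_sum] at h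
  rw [sub_sub, sub_eq_zero] at h
  rw [h]
  have h0 : ∀ z ∈ (filtration ρ ω ψ c).F 0, z ∈ (filtration ρ ω ψ c).below (1 + 1) :=
    fun z hz => (filtration ρ ω ψ c).mono zero_le_one hz
  refine h0 _ (add_mem (Submodule.smul_mem _ _ (filtration ρ ω ψ c).one_mem) ?_)
  exact Submodule.sum_mem _ fun s _ => Submodule.smul_mem _ _
    (toSRA_mem ρ ω ψ c (grp_mem ρ ψ s))

open scoped IsMulCommutative in
/-- The extension of `U → gr H_c(G,U,ψ)` to an algebra homomorphism `SU → gr H_c(G,U,ψ)`, which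
exists because the images of any two vectors commute. -/
def symToGr : SymmetricAlgebra ℂ U →ₐ[ℂ] GrSRA ρ ω ψ c :=
  have : IsMulCommutative (Algebra.adjoin ℂ (Set.range (grVec ρ ω ψ c))) :=
    Algebra.isMulCommutative_adjoin ℂ (by
      rintro _ ⟨x, rfl⟩ _ ⟨y, rfl⟩
      exact grVec_comm ρ ω ψ c x y)
  (Algebra.adjoin ℂ (Set.range (grVec ρ ω ψ c))).val.comp
    (SymmetricAlgebra.lift ((grVec ρ ω ψ c).codRestrict
      (Subalgebra.toSubmodule (Algebra.adjoin ℂ (Set.range (grVec ρ ω ψ c))))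
      fun x => Algebra.subset_adjoin ⟨x, rfl⟩))

open scoped IsMulCommutative in
theorem symToGr_ι (x : U) :
    symToGr ρ ω ψ c (SymmetricAlgebra.ι ℂ U x) = grVec ρ ω ψ c x := by
  have : IsMulCommutative (Algebra.adjoin ℂ (Set.range (grVec ρ ω ψ c))) :=
    Algebra.isMulCommutative_adjoin ℂ (by
      rintro _ ⟨x, rfl⟩ _ ⟨y, rfl⟩
      exact grVec_comm ρ ω ψ c x y)
  exact congrArg Subtype.val (SymmetricAlgebra.lift_ι_apply
    (A := Algebra.adjoin ℂ (Set.range (grVec ρ ω ψ c))) _ x)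

theorem grGrp_one : grGrp ρ ω ψ c 1 = (ψ 1 1 : ℂ) • (1 : GrSRA ρ ω ψ c) := by
  rw [← AlgFiltration.grMk_one, ← AlgFiltration.grMk_smul]
  refine AlgFiltration.grMk_eq _ rfl _ _ ?_
  rw [grp, of_one, map_smul, map_one, sub_self]
  exact zero_mem _

theorem grGrp_mul (g h : G) :
    grGrp ρ ω ψ c g * grGrp ρ ω ψ c h = (ψ g h : ℂ) • grGrp ρ ω ψ c (g * h) := by
  unfold grGrp
  rw [AlgFiltration.grMk_mul, ← AlgFiltration.grMk_smul]
  refine AlgFiltration.grMk_eq _ rfl _ _ ?_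
  rw [← map_mul, grp, grp, of_mul_of, map_smul, grp, sub_self]
  exact zero_mem _

theorem grGrp_mul_symToGr (g : G) (a : SymmetricAlgebra ℂ U) :
    grGrp ρ ω ψ c g * symToGr ρ ω ψ c a
      = symToGr ρ ω ψ c (symAction ρ g a) * grGrp ρ ω ψ c g := by
  induction a using SymmetricAlgebra.induction with
  | algebraMap r => simp only [AlgHom.commutes]; exact (Algebra.commutes r _).symm
  | ι x =>
    rw [symAction_ι, symToGr_ι, symToGr_ι]
    refine ((filtration ρ ω ψ c).grMk_mul _ _).trans (Eq.trans ?_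
      ((filtration ρ ω ψ c).grMk_mul _ _).symm)
    refine AlgFiltration.grMk_eq _ rfl _ _ ?_
    rw [← map_mul, ← map_mul, grp, vec, vec, of_mul_base, tensorAction_ι, sub_self]
    exact zero_mem _
  | mul a b ha hb =>
    rw [map_mul, map_mul, map_mul, ← mul_assoc, ha, mul_assoc, hb, mul_assoc]
  | add a b ha hb => rw [map_add, map_add, map_add, mul_add, ha, hb, add_mul]

/-- The natural homomorphism `φ : SU ⋊ ℂ_ψ G → gr H_c(G,U,ψ)`, extending the tautological maps
of `U` and of `G` to `gr H_c(G,U,ψ)`. -/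
def pbwMap : SymCrossed ρ ψ →ₐ[ℂ] GrSRA ρ ω ψ c :=
  lift (symToGr ρ ω ψ c) (grGrp ρ ω ψ c) (grGrp_one ρ ω ψ c) (grGrp_mul ρ ω ψ c)
    (grGrp_mul_symToGr ρ ω ψ c)

theorem pbwMap_vec (x : U) :
    pbwMap ρ ω ψ c (base (symAction ρ) ψ (SymmetricAlgebra.ι ℂ U x)) = grVec ρ ω ψ c x := by
  have h := lift_single (symToGr ρ ω ψ c) (grGrp ρ ω ψ c) (grGrp_one ρ ω ψ c)
    (grGrp_mul ρ ω ψ c) (grGrp_mul_symToGr ρ ω ψ c) 1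
    ((((ψ 1 1)⁻¹ : ℂˣ) : ℂ) • SymmetricAlgebra.ι ℂ U x)
  refine h.trans ?_
  rw [map_smul, symToGr_ι, grGrp_one, smul_mul_smul_comm, mul_one]
  simp

theorem pbwMap_grp (g : G) : pbwMap ρ ω ψ c (of (symAction ρ) ψ g) = grGrp ρ ω ψ c g := by
  have h := lift_single (symToGr ρ ω ψ c) (grGrp ρ ω ψ c) (grGrp_one ρ ω ψ c)
    (grGrp_mul ρ ω ψ c) (grGrp_mul_symToGr ρ ω ψ c) g 1
  refine h.trans ?_
  rw [map_one, one_mul]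

/-- The degree `n` part `S^n U ⊗ ℂ_ψ G` of `SU ⋊ ℂ_ψ G`. -/
def symPart (n : ℕ) : Submodule ℂ (SymCrossed ρ ψ) :=
  coeffIn (symAction ρ) ψ (LinearMap.range (SymmetricAlgebra.ι ℂ U) ^ n)

end SRA
end TwistedSRA

end

/-!
The associated graded algebra of `H_c(G,U,ψ)` is generated by the images of `U` and `G`, which
satisfy the relations of `SU ⋊ ℂ_ψ G`, so `φ` maps `S^n U ⊗ ℂ_ψ G` onto `F_n / F_{n-1}`
(`map_symPart`). The point is injectivity, and for this an action of `H_c(G,U,ψ)` on the space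
`B = SU ⋊ ℂ_ψ G` is constructed in which `x ∈ U` acts by `x ▷ m = x m + θ(x, m)`, where `θ(x, ·)`
lowers the degree, and `g ∈ G` by left multiplication. If such an action exists, then an element
of `H_c(G,U,ψ)` represented by a homogeneous tensor `t` of degree `n` sends `1` to the
symmetrization of `t` plus terms of lower degree, while the elements of `F_{n-1}` send `1` to
elements of degree less than `n`; so the symmetrization of `t` vanishes if `t` represents an element
of `F_{n-1}` (`symmetrize_eq_zero`).

With `κ(x,y) = ω(x,y) + ∑ c(s) ω_s(x,y) s`, the relations require
`θ(x, y m) - θ(y, x m) = Φ(x,y,m)` for `Φ(x,y,m) = κ(y,x) m - x ▷ θ(y,m) + y ▷ θ(x,m)`. In this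
equation `Φ` on degree `n` involves `θ` only in degrees at most `n`, so the equation can be solved
by recursion on the degree, provided that `Φ` is a cocycle for the Koszul differential. A solution
is then given by Euler's homotopy: `θ(x, y₁ ⋯ yₙ)` is the average, with denominator `n + 1`, of the
`Φ(x, yᵢ, y₁ ⋯ ŷᵢ ⋯ yₙ)` (`contract_koszul`). This formula is equivariant and independent of any
choice of a basis of `U`, which may have infinite dimension. The operator `θ` is obtained as the
fixed point of the formula (`correction`), and the cocycle condition is verified by induction on the
degree (`vecOp_comm`). It reduces to two properties of `κ`.

* Equivariance: `g κ(x,y) = κ(gx,gy) g` in `ℂ_ψ G` (`of_mul_kappa`). This is where the class-function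
  property of `ψ` enters. In `ℂ_ψ G`, conjugation by `g` sends a regular element `s` to a multiple of
  `g s g⁻¹`. Some character of `ℂ_ψ G` does not vanish at `s`, because the sum of the conjugates of
  `s` is central and not nilpotent (`IsRegular.exists_trace_ne_zero`), and this character takes the
  same value at `g s g⁻¹`; so the factor is `1`.
* The Jacobi identity: the cyclic sum of the `ω_s(x,y) (s z - z)` vanishes
  (`reflectionForm_cyclic`), since it is an alternating trilinear map on the plane `Im (1 - s)`.
-/

noncomputable section
namespace TwistedSRA
open CrossedProduct

/-! ### Characters of the twisted group algebra at regular elements -/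

section CrossedProductBasis

variable {G : Type u} [Group G] [Fintype G] {A : Type v} [Ring A] [Algebra ℂ A]
  (α : G →* (A →ₐ[ℂ] A)) (ψ : TwoCocycle G)

/-- The inverse of the basis element `g` of `ℂ_ψ G`, in a crossed product. -/
def CrossedProduct.ofInv (g : G) : CrossedProduct α ψ :=
  (((ψ g g⁻¹ * ψ 1 1)⁻¹ : ℂˣ) : ℂ) • of α ψ g⁻¹

theorem CrossedProduct.of_mul_ofInv (g : G) : of α ψ g * ofInv α ψ g = 1 := by
  rw [ofInv, mul_smul_comm, of_mul_of, mul_inv_cancel, of_one, smul_smul, smul_smul,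
    ← Units.val_mul, ← Units.val_mul]
  simp

theorem CrossedProduct.ofInv_mul_of (g : G) : ofInv α ψ g * of α ψ g = 1 := by
  have h := ψ.cocycle g g⁻¹ g
  rw [mul_inv_cancel, inv_mul_cancel, ψ.one_left, ψ.one_right] at h
  rw [ofInv, smul_mul_assoc, of_mul_of, inv_mul_cancel, of_one, smul_smul, smul_smul,
    ← Units.val_mul, ← Units.val_mul, h, ψ.one_right, mul_assoc, inv_mul_cancel, Units.val_one,
    one_smul]

theorem CrossedProduct.of_apply [DecidableEq G] (g h : G) :
    of α ψ g h = if h = g then 1 else 0 := single_apply g h 1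

/-- Conjugation by a basis element permutes the basis elements up to scalars. -/
theorem CrossedProduct.of_mul_of_eq_smul (g s : G) :
    of α ψ g * of α ψ s
      = ((ψ g s / ψ (g * s * g⁻¹) g : ℂˣ) : ℂ) • (of α ψ (g * s * g⁻¹) * of α ψ g) := by
  rw [of_mul_of, of_mul_of, smul_smul, ← Units.val_mul, div_mul_cancel]
  simp

theorem CrossedProduct.conj_of_eq_smul (g s : G) :
    of α ψ g * of α ψ s * ofInv α ψ g
      = ((ψ g s / ψ (g * s * g⁻¹) g : ℂˣ) : ℂ) • of α ψ (g * s * g⁻¹) := by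
  rw [of_mul_of_eq_smul, smul_mul_assoc, mul_assoc (of α ψ (g * s * g⁻¹)), of_mul_ofInv, mul_one]

end CrossedProductBasis

section TwistedGroup

variable {G : Type u} [Group G] [Fintype G] (α : G →* (ℂ →ₐ[ℂ] ℂ)) (ψ : TwoCocycle G)

/-- The sum of all conjugates of the basis element `s` of `ℂ_ψ G`. -/
def conjSum (s : G) : CrossedProduct α ψ :=
  ∑ g : G, of α ψ g * of α ψ s * ofInv α ψ g

theorem eq_sum_smul_of (a : CrossedProduct α ψ) : a = ∑ g : G, a g • of α ψ g := by
  classical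
  ext h
  rw [CrossedProduct.sum_apply, Finset.sum_eq_single h]
  · rw [CrossedProduct.smul_apply, of_apply, if_pos rfl, smul_eq_mul, mul_one]
  · intro g _ hg
    rw [CrossedProduct.smul_apply, of_apply, if_neg hg.symm, smul_zero]
  · simp

theorem of_mul_conjSum (s h : G) : of α ψ h * conjSum α ψ s = conjSum α ψ s * of α ψ h := by
  unfold conjSum
  rw [Finset.mul_sum, Finset.sum_mul]
  refine Fintype.sum_equiv (Equiv.mulLeft h) _ _ fun g => ?_
  have e : of α ψ h * of α ψ g = (ψ h g : ℂ) • of α ψ (h * g) := of_mul_of h g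
  -- the scalar `ψ(h,g)` by which `h · g` and `hg` differ cancels in a conjugate
  have e' : ofInv α ψ (h * g) * of α ψ h = (ψ h g : ℂ) • ofInv α ψ g := by
    calc ofInv α ψ (h * g) * of α ψ h
        = ofInv α ψ (h * g) * (of α ψ h * (of α ψ g * ofInv α ψ g)) := by
          rw [of_mul_ofInv, mul_one]
      _ = ofInv α ψ (h * g) * (of α ψ h * of α ψ g) * ofInv α ψ g := by simp only [mul_assoc]
      _ = _ := by rw [e, mul_smul_comm, ofInv_mul_of, smul_mul_assoc, one_mul]
  simp only [Equiv.coe_mulLeft]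
  rw [mul_assoc _ _ (of α ψ h), e', ← mul_assoc, ← mul_assoc, e]
  simp only [smul_mul_assoc, mul_smul_comm]

theorem mul_conjSum (s : G) (a : CrossedProduct α ψ) :
    a * conjSum α ψ s = conjSum α ψ s * a := by
  rw [eq_sum_smul_of α ψ a, Finset.sum_mul, Finset.mul_sum]
  refine Finset.sum_congr rfl fun g _ => ?_
  rw [smul_mul_assoc, of_mul_conjSum, mul_smul_comm]

theorem conjSum_apply_self {s : G} (hs : IsRegular ψ s) : conjSum α ψ s s ≠ 0 := by
  classical
  have h : ∀ g : G, (of α ψ g * of α ψ s * ofInv α ψ g) s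
      = (if g * s = s * g then 1 else 0 : ℂ) := fun g => by
    split_ifs with hg
    · have hc : ψ s g = ψ g s := hs g (by rw [Subgroup.mem_centralizer_singleton_iff]; exact hg)
      rw [conj_of_eq_smul, hg, mul_inv_cancel_right, hc, div_self', Units.val_one, one_smul,
        of_apply, if_pos rfl]
    · have : s ≠ g * s * g⁻¹ := fun h => hg (eq_mul_inv_iff_mul_eq.mp h).symm
      rw [conj_of_eq_smul, CrossedProduct.smul_apply, of_apply, if_neg this, smul_zero]
  unfold conjSum
  rw [CrossedProduct.sum_apply, Finset.sum_congr rfl fun g _ => h g, Finset.sum_boole]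
  simp only [ne_eq, Nat.cast_eq_zero, Finset.card_eq_zero]
  exact Finset.ne_empty_of_mem (a := 1) (by simp)

instance : Module.Finite ℂ (CrossedProduct α ψ) :=
  inferInstanceAs (Module.Finite ℂ (G → ℂ))

/-- The trace of left multiplication by `a` on `ℂ_ψ G` is, up to a nonzero factor, the
coefficient of `1 ∈ G` in `a`. -/
theorem trace_mulLeft (a : CrossedProduct α ψ) :
    LinearMap.trace ℂ (CrossedProduct α ψ) (LinearMap.mulLeft ℂ a)
      = Fintype.card G * (ψ 1 1 * a 1) := by
  classical
  let b : Module.Basis G ℂ (CrossedProduct α ψ) := Pi.basisFun ℂ G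
  rw [LinearMap.trace_eq_matrix_trace ℂ b, Matrix.trace]
  have h : ∀ g : G, Matrix.diag (LinearMap.toMatrix b b (LinearMap.mulLeft ℂ a)) g
      = ψ 1 1 * a 1 := fun g => by
    have e : b g = of α ψ g := by
      ext k
      rw [of_apply]
      exact (congrFun (Pi.basisFun_apply ℂ G g) k).trans (Pi.single_apply g 1 k)
    rw [Matrix.diag_apply, LinearMap.toMatrix_apply, e]
    change (a * of α ψ g) g = _
    rw [mul_apply, Finset.sum_eq_single 1]
    · rw [of_apply, inv_one, one_mul, if_pos rfl, ψ.one_left, map_one, mul_one, smul_eq_mul]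
    · intro k _ hk
      rw [of_apply, if_neg, map_zero, mul_zero, smul_zero]
      simpa using hk
    · simp
  rw [Finset.sum_congr rfl fun g _ => h g]
  simp

theorem exists_eigenvalue_ne_zero {V : Type*} [AddCommGroup V] [Module ℂ V]
    [FiniteDimensional ℂ V] {f : Module.End ℂ V} (hf : ¬ IsNilpotent f) :
    ∃ μ : ℂ, μ ≠ 0 ∧ f.HasEigenvalue μ := by
  by_contra! h
  apply hf
  have h0 : f.maxGenEigenspace 0 = ⊤ := by
    rw [← Module.End.iSup_maxGenEigenspace_eq_top f]
    refine le_antisymm (le_iSup (fun μ => f.maxGenEigenspace μ) 0) (iSup_le fun μ => ?_)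
    by_cases hμ : μ = 0
    · rw [hμ]
    · have := h μ hμ
      have e : f.maxGenEigenspace μ = ⊥ := by
        by_contra hne
        exact this (Module.End.hasEigenvalue_of_hasGenEigenvalue (k := Module.finrank ℂ V)
          (by rwa [Module.End.maxGenEigenspace_eq_genEigenspace_finrank] at hne))
      rw [e]
      exact bot_le
  refine ⟨Module.finrank ℂ V, ?_⟩
  rw [Module.End.maxGenEigenspace_eq_genEigenspace_finrank, Module.End.genEigenspace_nat] at h0
  rw [zero_smul, sub_zero] at h0
  exact LinearMap.ker_eq_top.mp h0

/-- Multiplication by the central element `conjSum s` is not nilpotent, since its product with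
multiplication by `s⁻¹` has nonzero trace. -/
theorem not_isNilpotent_mulLeft_conjSum {s : G} (hs : IsRegular ψ s) :
    ¬ IsNilpotent (LinearMap.mulLeft ℂ (conjSum α ψ s)) := by
  classical
  intro hn
  have hc : Commute (LinearMap.mulLeft ℂ (conjSum α ψ s)) (LinearMap.mulLeft ℂ (of α ψ s⁻¹)) := by
    rw [commute_iff_eq, Module.End.mul_eq_comp, Module.End.mul_eq_comp, ← LinearMap.mulLeft_mul,
      ← LinearMap.mulLeft_mul, mul_conjSum]
  have h := LinearMap.isNilpotent_trace_of_isNilpotent (hc.isNilpotent_mul_right hn)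
  rw [Module.End.mul_eq_comp, ← LinearMap.mulLeft_mul, trace_mulLeft, isNilpotent_iff_eq_zero] at h
  have e : (conjSum α ψ s * of α ψ s⁻¹) 1 = (ψ s s⁻¹ : ℂ) * conjSum α ψ s s := by
    rw [mul_apply, Finset.sum_eq_single s]
    · rw [of_apply, mul_one, if_pos rfl, map_one, mul_one, smul_eq_mul]
    · intro k _ hk
      rw [of_apply, if_neg, map_zero, mul_zero, smul_zero]
      simpa using hk
    · simp
  rw [e] at h
  simp [conjSum_apply_self α ψ hs, Fintype.card_ne_zero] at h

/-- Some character of `ℂ_ψ G` does not vanish at a given regular element `s`. The representation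
is an eigenspace of the central element `conjSum s`, for a nonzero eigenvalue. -/
theorem IsRegular.exists_trace_ne_zero {ψ : TwoCocycle G} {s : G} (hs : IsRegular ψ s) :
    ∃ (V : Type u) (_ : AddCommGroup V) (_ : Module ℂ V) (_ : FiniteDimensional ℂ V)
      (τ : CrossedProduct α ψ →ₐ[ℂ] Module.End ℂ V),
      LinearMap.trace ℂ V (τ (of α ψ s)) ≠ 0 := by
  obtain ⟨μ, hμ, hev⟩ := exists_eigenvalue_ne_zero (not_isNilpotent_mulLeft_conjSum α ψ hs)
  set W : Submodule ℂ (CrossedProduct α ψ) :=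
    Module.End.eigenspace (LinearMap.mulLeft ℂ (conjSum α ψ s)) μ with hW
  have hmem : ∀ a, ∀ x ∈ W, LinearMap.mulLeft ℂ a x ∈ W := fun a x hx => by
    rw [hW, Module.End.mem_eigenspace_iff, LinearMap.mulLeft_apply] at hx ⊢
    rw [LinearMap.mulLeft_apply, ← mul_assoc, ← mul_conjSum, mul_assoc, hx, mul_smul_comm]
  let τ : CrossedProduct α ψ →ₐ[ℂ] Module.End ℂ W := AlgHom.ofLinearMap
    { toFun := fun a => (LinearMap.mulLeft ℂ a).restrict (hmem a)
      map_add' := fun a b => by ext x : 2; exact add_mul a b (x : CrossedProduct α ψ)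
      map_smul' := fun r a => by ext x : 2; exact smul_mul_assoc r a (x : CrossedProduct α ψ) }
    (by ext x : 2; exact one_mul (x : CrossedProduct α ψ))
    (fun a b => by ext x : 2; exact mul_assoc a b (x : CrossedProduct α ψ))
  refine ⟨W, inferInstance, inferInstance, inferInstance, τ, fun h0 => ?_⟩
  have h1 : LinearMap.trace ℂ W (τ (conjSum α ψ s)) = 0 := by
    unfold conjSum
    rw [map_sum, map_sum]
    refine Finset.sum_eq_zero fun g _ => ?_
    rw [map_mul, LinearMap.trace_mul_comm, ← map_mul, ← mul_assoc, ofInv_mul_of, one_mul, h0]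
  have h2 : τ (conjSum α ψ s) = μ • (1 : Module.End ℂ W) := by
    ext x : 2
    exact Module.End.mem_eigenspace_iff.mp x.2
  rw [h2, map_smul, LinearMap.trace_one, smul_eq_mul, mul_eq_zero, Nat.cast_eq_zero] at h1
  have hne : W ≠ ⊥ := hev
  rcases h1 with h1 | h1
  · exact hμ h1
  · exact hne (Submodule.finrank_eq_zero.mp h1)

/-- For a class-function cocycle, conjugation in `ℂ_ψ G` sends a regular element to its conjugate
in `G`, without a scalar factor: the factor is detected by a character that does not vanish. -/
theorem TwoCocycle.IsClassFunction.eq_of_isRegular {ψ : TwoCocycle G} (hψ : ψ.IsClassFunction)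
    {s : G} (hs : IsRegular ψ s) (g : G) : ψ g s = ψ (g * s * g⁻¹) g := by
  obtain ⟨V, _, _, _, τ, hτ⟩ := hs.exists_trace_ne_zero 1
  have h := hψ V τ s g
  have e := congrArg (fun a => LinearMap.trace ℂ V (τ a)) (conj_of_eq_smul 1 ψ g s)
  rw [map_mul τ, LinearMap.trace_mul_comm ℂ, ← map_mul, ← mul_assoc, ofInv_mul_of, one_mul,
    map_smul, map_smul, h, smul_eq_mul, eq_comm, mul_eq_right₀ hτ] at e
  exact div_eq_one.mp (Units.val_eq_one.mp e)

/-- Regularity of `s` says that `s` commutes in `ℂ_ψ G` with its centralizer in `G`. -/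
theorem isRegular_iff {s : G} :
    IsRegular ψ s ↔ ∀ h, h * s = s * h → of α ψ h * of α ψ s = of α ψ s * of α ψ h := by
  classical
  refine forall_congr' fun h => ?_
  rw [Subgroup.mem_centralizer_singleton_iff]
  refine forall_congr' fun hc => ?_
  rw [of_mul_of, of_mul_of, hc]
  refine ⟨fun e => by rw [e], fun e => ?_⟩
  have e' := congrFun e (s * h)
  simp only [CrossedProduct.smul_apply, of_apply, if_true] at e'
  exact (Units.val_injective (by simpa using e')).symm

theorem IsRegular.conj {ψ : TwoCocycle G} {s : G} (hs : IsRegular ψ s) (g : G) :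
    IsRegular ψ (g * s * g⁻¹) := by
  rw [isRegular_iff (1 : G →* (ℂ →ₐ[ℂ] ℂ))] at hs ⊢
  generalize (1 : G →* (ℂ →ₐ[ℂ] ℂ)) = α at hs ⊢
  intro h hh
  have e : g * (g⁻¹ * h * g) * g⁻¹ = h := by group
  have hc := hs (g⁻¹ * h * g) (by
    calc g⁻¹ * h * g * s = g⁻¹ * (h * (g * s * g⁻¹)) * g := by group
      _ = s * (g⁻¹ * h * g) := by rw [hh]; group)
  have hX := conj_of_eq_smul α ψ g (g⁻¹ * h * g)
  rw [e] at hX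
  have hY := conj_of_eq_smul α ψ g s
  have key : ∀ a b : CrossedProduct α ψ,
      of α ψ g * a * ofInv α ψ g * (of α ψ g * b * ofInv α ψ g)
        = of α ψ g * (a * b) * ofInv α ψ g := fun a b => by
    calc _ = of α ψ g * a * (ofInv α ψ g * of α ψ g) * b * ofInv α ψ g := by
          simp only [mul_assoc]
      _ = _ := by rw [ofInv_mul_of, mul_one]; simp only [mul_assoc]
  have h1 := key (of α ψ (g⁻¹ * h * g)) (of α ψ s)
  rw [hc, ← key, hX, hY, smul_mul_smul_comm, smul_mul_smul_comm, mul_comm, ← Units.val_mul] at h1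
  exact smul_right_injective _ (Units.ne_zero _) h1

end TwistedGroup

/-! ### The commutator form and its Jacobi identity -/

section Reflections

variable {G : Type u} [Group G] [Fintype G] {U : Type v} [AddCommGroup U] [Module ℂ U]
  {ρ : Representation ℂ G U} {ω : LinearMap.BilinForm ℂ U} {ψ : TwoCocycle G}

theorem one_sub_conj_apply (g s : G) (x : U) :
    (1 - ρ (g * s * g⁻¹)) (ρ g x) = ρ g ((1 - ρ s) x) := by
  simp

theorem range_one_sub_conj (g s : G) :
    LinearMap.range (1 - ρ (g * s * g⁻¹)) = (LinearMap.range (1 - ρ s)).map (ρ g) := by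
  ext y
  constructor
  · rintro ⟨x, rfl⟩
    refine ⟨(1 - ρ s) (ρ g⁻¹ x), ⟨_, rfl⟩, ?_⟩
    rw [← one_sub_conj_apply, ← Module.End.mul_apply (ρ g), ← map_mul, mul_inv_cancel, map_one,
      Module.End.one_apply]
  · rintro ⟨_, ⟨x, rfl⟩, rfl⟩
    exact ⟨ρ g x, one_sub_conj_apply g s x⟩

theorem conj_mem_regularReflections (hρ : ∀ (g : G) (x y : U), ω (ρ g x) (ρ g y) = ω x y) (g : G)
    {s : G} (hs : s ∈ regularReflections ρ ω ψ) : g * s * g⁻¹ ∈ regularReflections ρ ω ψ := by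
  refine ⟨⟨hρ _, ?_⟩, hs.2.conj g⟩
  have hinj : Function.Injective (ρ g) :=
    Function.LeftInverse.injective (g := ρ g⁻¹) fun x => by
      rw [← Module.End.mul_apply, ← map_mul]; simp
  rw [range_one_sub_conj, ← hs.1.2]
  exact (Submodule.equivMapOfInjective (ρ g) hinj _).finrank_eq.symm

theorem projection_conj (g s : G) (x : U) :
    Submodule.projection _ _ (isCompl_range_ker ρ (g * s * g⁻¹)) (ρ g x)
      = ρ g (Submodule.projection _ _ (isCompl_range_ker ρ s) x) := by
  set p := Submodule.projection _ _ (isCompl_range_ker ρ s) x with hp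
  have h1 : x - p ∈ LinearMap.ker (1 - ρ s) := by
    rw [← Submodule.projection_apply_eq_zero_iff (isCompl_range_ker ρ s), map_sub, hp,
      Submodule.projection_apply_of_mem_left _ (Submodule.projection_apply_mem _ x), sub_self]
  have h2 : p ∈ LinearMap.range (1 - ρ s) := Submodule.projection_apply_mem _ x
  have e : ρ g x = ρ g p + ρ g (x - p) := by rw [← map_add, add_sub_cancel]
  rw [e, map_add, Submodule.projection_apply_of_mem_left, Submodule.projection_apply_of_mem_right,
    add_zero]
  · rw [LinearMap.mem_ker, one_sub_conj_apply, LinearMap.mem_ker.mp h1, map_zero]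
  · rw [range_one_sub_conj]
    exact ⟨p, h2, rfl⟩

theorem reflectionForm_conj (hρ : ∀ (g : G) (x y : U), ω (ρ g x) (ρ g y) = ω x y) (g s : G)
    (x y : U) :
    reflectionForm ρ ω (g * s * g⁻¹) (ρ g x) (ρ g y) = reflectionForm ρ ω s x y := by
  simp only [reflectionForm, LinearMap.compl₁₂_apply, projection_conj, hρ]

theorem reflectionForm_self (hω : ω.IsAlt) (s : G) (x : U) : reflectionForm ρ ω s x x = 0 :=
  hω _

/-- In a plane, the alternating trilinear map made from an alternating form vanishes. -/
theorem cyclic_sum_eq_zero_of_finrank_eq_two (hω : ω.IsAlt) {R : Submodule ℂ U}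
    (hR : Module.finrank ℂ R = 2) {x y z : U} (hx : x ∈ R) (hy : y ∈ R) (hz : z ∈ R) :
    ω x y • z + ω y z • x + ω z x • y = 0 := by
  have : Module.Finite ℂ R := Module.finite_of_finrank_pos (by omega)
  let b := Module.finBasisOfFinrankEq ℂ R hR
  have hb : ∀ v ∈ R, ∃ p q : ℂ, v = p • (b 0 : U) + q • (b 1 : U) := fun v hv => by
    refine ⟨b.repr ⟨v, hv⟩ 0, b.repr ⟨v, hv⟩ 1, ?_⟩
    have h := congrArg Subtype.val (b.sum_repr ⟨v, hv⟩)
    rw [Fin.sum_univ_two] at h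
    exact h.symm
  obtain ⟨p, q, rfl⟩ := hb x hx
  obtain ⟨p', q', rfl⟩ := hb y hy
  obtain ⟨p'', q'', rfl⟩ := hb z hz
  have h10 : ω (b 1) (b 0) = - ω (b 0) (b 1) := (LinearMap.BilinForm.IsAlt.neg_eq hω _ _).symm
  simp only [map_add, map_smul, LinearMap.add_apply, LinearMap.smul_apply, smul_eq_mul,
    hω (b 0), hω (b 1), h10]
  module

/-- The Jacobi identity for the commutator form, for the contribution of one reflection `s`. -/
theorem reflectionForm_cyclic (hω : ω.IsAlt) {s : G}
    (hs : Module.finrank ℂ (LinearMap.range (1 - ρ s)) = 2) (x y z : U) :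
    reflectionForm ρ ω s x y • (ρ s z - z) + reflectionForm ρ ω s y z • (ρ s x - x)
      + reflectionForm ρ ω s z x • (ρ s y - y) = 0 := by
  set P := Submodule.projection _ _ (isCompl_range_ker ρ s) with hP
  have hmem : ∀ v, P v ∈ LinearMap.range (1 - ρ s) := fun v => Submodule.projection_apply_mem _ v
  have h1 : ∀ v, ρ s v - v = (ρ s - 1) (P v) := fun v => by
    have h : v - P v ∈ LinearMap.ker (1 - ρ s) := by
      rw [← Submodule.projection_apply_eq_zero_iff (isCompl_range_ker ρ s), map_sub,
        Submodule.projection_apply_of_mem_left _ (hmem v), sub_self]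
    rw [LinearMap.mem_ker, map_sub, sub_eq_zero] at h
    rw [← neg_sub (1 : Module.End ℂ U), LinearMap.neg_apply, ← h]
    simp
  have h2 := congrArg (ρ s - 1 : Module.End ℂ U)
    (cyclic_sum_eq_zero_of_finrank_eq_two hω hs (hmem x) (hmem y) (hmem z))
  simp only [map_add, map_smul, map_zero] at h2
  rw [h1, h1, h1]
  exact h2

end Reflections

section CommutatorForm

variable {G : Type u} [Group G] [Fintype G] {U : Type v} [AddCommGroup U] [Module ℂ U]
  {A : Type w} [Ring A] [Algebra ℂ A] (α : G →* (A →ₐ[ℂ] A))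
  (ρ : Representation ℂ G U) (ω : LinearMap.BilinForm ℂ U) (ψ : TwoCocycle G)
  (c : regularReflections ρ ω ψ → ℂ)

open Classical in
/-- The form `κ(x,y) = ω(x,y) · 1 + ∑ s, c(s) ω_s(x,y) s` with values in `ℂ_ψ G`, considered inside
a crossed product with `ℂ_ψ G`. -/
def kappa : U →ₗ[ℂ] U →ₗ[ℂ] CrossedProduct α ψ :=
  ω.compr₂ (LinearMap.toSpanSingleton ℂ (CrossedProduct α ψ) 1)
    + ∑ s : regularReflections ρ ω ψ,
      c s • (reflectionForm ρ ω s).compr₂ (LinearMap.toSpanSingleton ℂ _ (of α ψ s))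

open Classical in
theorem kappa_apply (x y : U) : kappa α ρ ω ψ c x y
    = ω x y • (1 : CrossedProduct α ψ)
      + ∑ s : regularReflections ρ ω ψ, (c s * reflectionForm ρ ω s x y) • of α ψ s := by
  simp [kappa, LinearMap.sum_apply, smul_smul]

/-- The defining relations express that the commutators of vectors are given by `κ`. -/
theorem relator_eq (x y : U) : relator ρ ω ψ c x y
    = vec ρ ψ y * vec ρ ψ x - vec ρ ψ x * vec ρ ψ y - kappa (tensorAction ρ) ρ ω ψ c x y := by
  rw [kappa_apply, relator, sub_sub]
  rfl

variable {ρ ω ψ c}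

theorem kappa_self (hω : ω.IsAlt) (x : U) : kappa α ρ ω ψ c x x = 0 := by
  classical
  rw [kappa_apply, hω x, zero_smul, zero_add]
  exact Finset.sum_eq_zero fun s _ => by rw [reflectionForm_self hω, mul_zero, zero_smul]

theorem kappa_swap (hω : ω.IsAlt) (x y : U) :
    kappa α ρ ω ψ c x y = - kappa α ρ ω ψ c y x := by
  have h := kappa_self α (c := c) hω (x + y)
  simp only [map_add, LinearMap.add_apply, kappa_self α hω, zero_add, add_zero] at h
  exact eq_neg_of_add_eq_zero_right h

/-- Equivariance of the commutator form. -/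
theorem of_mul_kappa (hρ : ∀ (g : G) (x y : U), ω (ρ g x) (ρ g y) = ω x y)
    (hψ : ψ.IsClassFunction)
    (hc : ∀ (g : G) (s t : regularReflections ρ ω ψ), (t : G) = g * (s : G) * g⁻¹ → c t = c s)
    (g : G) (x y : U) :
    of α ψ g * kappa α ρ ω ψ c x y = kappa α ρ ω ψ c (ρ g x) (ρ g y) * of α ψ g := by
  classical
  simp only [kappa_apply, mul_add, add_mul, hρ, mul_smul_comm, smul_mul_assoc, mul_one, one_mul,
    Finset.mul_sum, Finset.sum_mul]
  congr 1
  let e : regularReflections ρ ω ψ ≃ regularReflections ρ ω ψ :=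
    { toFun := fun s => ⟨g * s * g⁻¹, conj_mem_regularReflections hρ g s.2⟩
      invFun := fun s => ⟨g⁻¹ * s * g⁻¹⁻¹, conj_mem_regularReflections hρ g⁻¹ s.2⟩
      left_inv := fun s => Subtype.ext (by simp [mul_assoc])
      right_inv := fun s => Subtype.ext (by simp [mul_assoc]) }
  refine Fintype.sum_equiv e _ _ fun s => ?_
  have he : (e s : G) = g * s * g⁻¹ := rfl
  rw [hc g s (e s) he, he, reflectionForm_conj hρ, of_mul_of_eq_smul,
    ← hψ.eq_of_isRegular s.2.2 g, div_self', Units.val_one, one_smul]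

end CommutatorForm

/-! ### Grading and universal derivation of the symmetric algebra -/

section SymmetricAlgebra

variable (U : Type v) [AddCommGroup U] [Module ℂ U]

/-- The part of degree `n` of the symmetric algebra. -/
abbrev symDegree (n : ℕ) : Submodule ℂ (SymmetricAlgebra ℂ U) :=
  LinearMap.range (SymmetricAlgebra.ι ℂ U) ^ n

/-- The homomorphism `SU → SU[t]` that sends a vector `x` to `t x`, so that an element `a` of
degree `n` is sent to `tⁿ a`. -/
def symScale : SymmetricAlgebra ℂ U →ₐ[ℂ] Polynomial (SymmetricAlgebra ℂ U) :=
  SymmetricAlgebra.lift ((Polynomial.monomial 1).restrictScalars ℂ ∘ₗ SymmetricAlgebra.ι ℂ U)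

variable {U}

theorem symScale_of_mem {n : ℕ} {a : SymmetricAlgebra ℂ U} (ha : a ∈ symDegree U n) :
    symScale U a = Polynomial.monomial n a := by
  induction ha using Submodule.pow_induction_on_left' with
  | algebraMap r => rw [AlgHom.commutes]; rfl
  | add x y i _ _ hx hy => rw [map_add, map_add, hx, hy]
  | mem_mul m hm i x _ hx =>
    obtain ⟨u, rfl⟩ := hm
    rw [map_mul, hx, symScale, SymmetricAlgebra.lift_ι_apply]
    simp [Polynomial.monomial_mul_monomial, add_comm]

/-- Components of different degrees are independent. -/
theorem eq_zero_of_mem_of_mem_iSup {n : ℕ} {a : SymmetricAlgebra ℂ U} (ha : a ∈ symDegree U n)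
    (h : a ∈ ⨆ k : Fin n, symDegree U k) : a = 0 := by
  have h1 : ∀ b ∈ ⨆ k : Fin n, symDegree U k, (symScale U b).coeff n = 0 := by
    intro b hb
    refine Submodule.iSup_induction _ (motive := fun b => (symScale U b).coeff n = 0) hb ?_ ?_ ?_
    · intro k b hb
      rw [symScale_of_mem hb, Polynomial.coeff_monomial, if_neg k.2.ne]
    · simp
    · intro x y hx hy
      rw [map_add, Polynomial.coeff_add, hx, hy, add_zero]
  have h2 := h1 a h
  rwa [symScale_of_mem ha, Polynomial.coeff_monomial, if_pos rfl] at h2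

theorem mem_iSup_symDegree (a : SymmetricAlgebra ℂ U) : a ∈ ⨆ n, symDegree U n := by
  induction a using SymmetricAlgebra.induction with
  | algebraMap r =>
    refine Submodule.mem_iSup_of_mem 0 ?_
    rw [symDegree, pow_zero]
    exact Submodule.algebraMap_mem r
  | ι x =>
    refine Submodule.mem_iSup_of_mem 1 ?_
    rw [symDegree, pow_one]
    exact ⟨x, rfl⟩
  | add a b ha hb => exact add_mem ha hb
  | mul a b ha hb =>
    have h : (⨆ n, symDegree U n) * (⨆ n, symDegree U n) ≤ ⨆ n, symDegree U n := by
      rw [Submodule.iSup_mul]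
      refine iSup_le fun i => ?_
      rw [Submodule.mul_iSup]
      refine iSup_le fun j => ?_
      rw [symDegree, symDegree, ← pow_add]
      exact le_iSup (symDegree U) (i + j)
    exact h (Submodule.mul_mem_mul ha hb)

variable (U) in
/-- The linear map that divides the elements of degree `n` by `n + 1`. -/
def symWeight : SymmetricAlgebra ℂ U →ₗ[ℂ] SymmetricAlgebra ℂ U :=
  Polynomial.lsum (fun n : ℕ => ((n + 1 : ℂ)⁻¹) • LinearMap.id) ∘ₗ (symScale U).toLinearMap

theorem symWeight_of_mem {n : ℕ} {a : SymmetricAlgebra ℂ U} (ha : a ∈ symDegree U n) :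
    symWeight U a = (n + 1 : ℂ)⁻¹ • a := by
  rw [symWeight, LinearMap.comp_apply, AlgHom.toLinearMap_apply, symScale_of_mem ha,
    Polynomial.lsum_apply, Polynomial.sum_monomial_index]
  · rfl
  · simp

open scoped TensorProduct

/-- The symmetric algebra has a derivation `d : SU → SU ⊗ U` with `d x = 1 ⊗ x` for vectors `x`;
it sends a product `y₁ ⋯ yₙ` to the sum of the `y₁ ⋯ ŷᵢ ⋯ yₙ ⊗ yᵢ`. -/
theorem exists_symDeriv : ∃ d : SymmetricAlgebra ℂ U →ₗ[ℂ] SymmetricAlgebra ℂ U ⊗[ℂ] U,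
    d 1 = 0 ∧ ∀ x a, d (SymmetricAlgebra.ι ℂ U x * a)
      = a ⊗ₜ x + (LinearMap.mulLeft ℂ (SymmetricAlgebra.ι ℂ U x)).rTensor U (d a) := by
  let b := Module.Basis.ofVectorSpace ℂ U
  let e := SymmetricAlgebra.equivMvPolynomial b
  let D := MvPolynomial.mkDerivation ℂ
    (fun i => (1 : MvPolynomial (Module.Basis.ofVectorSpaceIndex ℂ U) ℂ) ⊗ₜ[ℂ] b i)
  let d : SymmetricAlgebra ℂ U →ₗ[ℂ] SymmetricAlgebra ℂ U ⊗[ℂ] U :=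
    (e.symm.toLinearMap.rTensor U) ∘ₗ (D : _ →ₗ[ℂ] _) ∘ₗ e.toLinearMap
  have hsmul : ∀ (i : _) (t : MvPolynomial (Module.Basis.ofVectorSpaceIndex ℂ U) ℂ ⊗[ℂ] U),
      e.symm.toLinearMap.rTensor U
        ((MvPolynomial.X i : MvPolynomial (Module.Basis.ofVectorSpaceIndex ℂ U) ℂ) • t)
      = (LinearMap.mulLeft ℂ (SymmetricAlgebra.ι ℂ U (b i))).rTensor U
        (e.symm.toLinearMap.rTensor U t) := fun i t => by
    induction t using TensorProduct.induction_on with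
    | zero => simp
    | tmul p u => simp [TensorProduct.smul_tmul', e]
    | add s t hs ht => simp only [smul_add, map_add, hs, ht]
  refine ⟨d, by simp [d], fun x a => ?_⟩
  induction b.mem_span x using Submodule.span_induction with
  | mem x hx =>
    obtain ⟨i, rfl⟩ := hx
    have he : e (SymmetricAlgebra.ι ℂ U (b i)) = MvPolynomial.X i :=
      SymmetricAlgebra.equivMvPolynomial_ι_apply b i
    change e.symm.toLinearMap.rTensor U (D (e (SymmetricAlgebra.ι ℂ U (b i) * a))) = _
    rw [map_mul, he, Derivation.leibniz, map_add, hsmul, add_comm]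
    congr 1
    simp [D, MvPolynomial.mkDerivation_X, TensorProduct.smul_tmul']
  | zero => simp
  | add x y _ _ hx hy =>
    have hl : LinearMap.mulLeft ℂ (SymmetricAlgebra.ι ℂ U x + SymmetricAlgebra.ι ℂ U y)
        = LinearMap.mulLeft ℂ (SymmetricAlgebra.ι ℂ U x)
          + LinearMap.mulLeft ℂ (SymmetricAlgebra.ι ℂ U y) := by ext; simp [add_mul]
    simp only [map_add, add_mul, hx, hy, TensorProduct.tmul_add, hl, LinearMap.rTensor_add,
      LinearMap.add_apply]
    abel
  | smul r x _ hx =>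
    have hr : LinearMap.mulLeft ℂ (r • SymmetricAlgebra.ι ℂ U x)
        = r • LinearMap.mulLeft ℂ (SymmetricAlgebra.ι ℂ U x) := by ext; simp
    rw [map_smul, smul_mul_assoc, map_smul, hx, smul_add, TensorProduct.tmul_smul, hr,
      LinearMap.rTensor_smul, LinearMap.smul_apply]

variable (U) in
/-- The universal derivation `SU → SU ⊗ U`. -/
def symDeriv : SymmetricAlgebra ℂ U →ₗ[ℂ] SymmetricAlgebra ℂ U ⊗[ℂ] U :=
  exists_symDeriv.choose

theorem symDeriv_one : symDeriv U 1 = 0 := exists_symDeriv.choose_spec.1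

theorem symDeriv_ι_mul (x : U) (a : SymmetricAlgebra ℂ U) :
    symDeriv U (SymmetricAlgebra.ι ℂ U x * a) = a ⊗ₜ x
      + (LinearMap.mulLeft ℂ (SymmetricAlgebra.ι ℂ U x)).rTensor U (symDeriv U a) :=
  exists_symDeriv.choose_spec.2 x a

end SymmetricAlgebra

/-! ### Grading of the crossed product with the symmetric algebra -/

section Singles

variable {G : Type u} [Group G] {A : Type v} [Ring A] [Algebra ℂ A]
  (α : G →* (A →ₐ[ℂ] A)) (ψ : TwoCocycle G)

/-- The map `a ↦ a ⊗ g`, as a linear map. -/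
def CrossedProduct.singleₗ (g : G) : A →ₗ[ℂ] CrossedProduct α ψ where
  toFun := single α ψ g
  map_add' a b := by
    classical
    ext h
    simp only [CrossedProduct.add_apply, single_apply]
    split_ifs <;> simp
  map_smul' r a := by
    classical
    ext h
    simp only [CrossedProduct.smul_apply, single_apply, RingHom.id_apply]
    split_ifs <;> simp

theorem CrossedProduct.single_add (g : G) (a b : A) :
    single α ψ g (a + b) = single α ψ g a + single α ψ g b := map_add (singleₗ α ψ g) a b

theorem CrossedProduct.single_smul (g : G) (r : ℂ) (a : A) :
    single α ψ g (r • a) = r • single α ψ g a := map_smul (singleₗ α ψ g) r a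

/-- The coefficient of `g`, as a linear map. -/
def CrossedProduct.coeffₗ (g : G) : CrossedProduct α ψ →ₗ[ℂ] A where
  toFun m := m g
  map_add' _ _ := rfl
  map_smul' _ _ := rfl

variable {α ψ} [Fintype G]

theorem CrossedProduct.sum_single (m : CrossedProduct α ψ) : ∑ g, single α ψ g (m g) = m := by
  classical
  ext h
  rw [CrossedProduct.sum_apply, Finset.sum_eq_single h]
  · rw [single_apply, if_pos rfl]
  · intro g _ hg
    rw [single_apply, if_neg hg.symm]
  · simp

theorem CrossedProduct.base_mul_apply (a : A) (m : CrossedProduct α ψ) (g : G) :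
    (base α ψ a * m) g = a * m g := by
  classical
  rw [mul_apply, Finset.sum_eq_single 1]
  · rw [base, single_apply, if_pos rfl, inv_one, one_mul, map_one, AlgHom.one_apply, ψ.one_left,
      Units.smul_def, smul_mul_assoc, smul_smul, ← Units.val_mul, mul_inv_cancel, Units.val_one,
      one_smul]
  · intro h _ hh
    rw [base, single_apply, if_neg hh, zero_mul, smul_zero]
  · simp

theorem CrossedProduct.of_mul_apply (g : G) (m : CrossedProduct α ψ) (k : G) :
    (of α ψ g * m) k = (ψ g (g⁻¹ * k) : ℂ) • α g (m (g⁻¹ * k)) := by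
  classical
  rw [mul_apply, Finset.sum_eq_single g]
  · rw [of_apply, if_pos rfl, one_mul]
  · intro h _ hh
    rw [of_apply, if_neg hh, zero_mul, smul_zero]
  · simp

end Singles

section SymCrossed

variable {G : Type u} [Group G] [Fintype G] {U : Type v} [AddCommGroup U] [Module ℂ U]
  (ρ : Representation ℂ G U) (ψ : TwoCocycle G)

/-- A vector `x` of `U`, as an element of `SU ⋊ ℂ_ψ G`. -/
def symVec : U →ₗ[ℂ] SymCrossed ρ ψ where
  toFun x := base (symAction ρ) ψ (SymmetricAlgebra.ι ℂ U x)
  map_add' x y := by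
    rw [base, map_add, smul_add, single_add]
    rfl
  map_smul' r x := by
    rw [base, map_smul, smul_comm, single_smul]
    rfl

/-- The elements of degree less than `n` of `SU ⋊ ℂ_ψ G`. -/
def symLower (n : ℕ) : Submodule ℂ (SymCrossed ρ ψ) := ⨆ k : Fin n, symPart ρ ψ k

variable {ρ ψ}

theorem symVec_mul_apply (x : U) (m : SymCrossed ρ ψ) (g : G) :
    (symVec ρ ψ x * m) g = SymmetricAlgebra.ι ℂ U x * m g := base_mul_apply _ m g

theorem symVec_mul_single (x : U) (g : G) (a : SymmetricAlgebra ℂ U) :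
    symVec ρ ψ x * single (symAction ρ) ψ g a
      = single (symAction ρ) ψ g (SymmetricAlgebra.ι ℂ U x * a) := by
  classical
  ext h
  rw [symVec_mul_apply, single_apply, single_apply]
  split_ifs
  · rfl
  · rw [mul_zero]

theorem symVec_mul_comm (x y : U) (m : SymCrossed ρ ψ) :
    symVec ρ ψ x * (symVec ρ ψ y * m) = symVec ρ ψ y * (symVec ρ ψ x * m) := by
  ext g
  simp only [symVec_mul_apply]
  ring

theorem of_mul_symVec (g : G) (x : U) :
    of (symAction ρ) ψ g * symVec ρ ψ x = symVec ρ ψ (ρ g x) * of (symAction ρ) ψ g := by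
  refine (of_mul_base g _).trans ?_
  rw [symAction_ι]
  rfl

theorem one_mem_symPart : (1 : SymCrossed ρ ψ) ∈ symPart ρ ψ 0 := by
  rw [one_def]
  refine single_mem 1 ?_
  rw [pow_zero]
  exact Submodule.algebraMap_mem _

theorem symVec_mul_mem {n : ℕ} (x : U) {m : SymCrossed ρ ψ} (hm : m ∈ symPart ρ ψ n) :
    symVec ρ ψ x * m ∈ symPart ρ ψ (n + 1) := by
  intro g
  rw [symVec_mul_apply, pow_succ']
  exact Submodule.mul_mem_mul ⟨x, rfl⟩ (hm g)

theorem symAction_mem {n : ℕ} (g : G) {a : SymmetricAlgebra ℂ U} (ha : a ∈ symDegree U n) :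
    symAction ρ g a ∈ symDegree U n := by
  have h : (symDegree U n).map (symAction ρ g).toLinearMap ≤ symDegree U n := by
    rw [Submodule.map_pow]
    refine pow_le_pow_left' ?_ n
    rintro _ ⟨_, ⟨x, rfl⟩, rfl⟩
    exact ⟨ρ g x, by simp⟩
  exact h ⟨a, ha, rfl⟩

theorem of_mul_mem {n : ℕ} (g : G) {m : SymCrossed ρ ψ} (hm : m ∈ symPart ρ ψ n) :
    of (symAction ρ) ψ g * m ∈ symPart ρ ψ n := by
  intro k
  rw [of_mul_apply]
  exact Submodule.smul_mem _ _ (symAction_mem g (hm _))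

/-- The part of degree `n + 1` is spanned by the products of a vector with an element of
degree `n`. -/
theorem symPart_succ_le {n : ℕ} {V : Submodule ℂ (SymCrossed ρ ψ)}
    (h : ∀ x, ∀ m ∈ symPart ρ ψ n, symVec ρ ψ x * m ∈ V) : symPart ρ ψ (n + 1) ≤ V := by
  intro m hm
  rw [← sum_single m]
  refine Submodule.sum_mem _ fun g _ => ?_
  have hg := hm g
  rw [pow_succ'] at hg
  have h' : LinearMap.range (SymmetricAlgebra.ι ℂ U) * symDegree U n
      ≤ V.comap (singleₗ (symAction ρ) ψ g) := by
    refine Submodule.mul_le.mpr ?_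
    rintro _ ⟨x, rfl⟩ a ha
    change single (symAction ρ) ψ g _ ∈ V
    rw [← symVec_mul_single]
    exact h x _ (single_mem g ha)
  exact h' hg

theorem symPart_le_symLower {k n : ℕ} (h : k < n) : symPart ρ ψ k ≤ symLower ρ ψ n :=
  le_iSup (fun k : Fin n => symPart ρ ψ k) ⟨k, h⟩

theorem symLower_le {n : ℕ} {V : Submodule ℂ (SymCrossed ρ ψ)}
    (h : ∀ k < n, symPart ρ ψ k ≤ V) : symLower ρ ψ n ≤ V :=
  iSup_le fun k => h k k.2

theorem symLower_mono {k n : ℕ} (h : k ≤ n) : symLower ρ ψ k ≤ symLower ρ ψ n :=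
  symLower_le fun _ hi => symPart_le_symLower (hi.trans_le h)

theorem symLower_zero : symLower ρ ψ 0 = ⊥ :=
  le_bot_iff.mp (symLower_le fun _ h => absurd h (Nat.not_lt_zero _))

theorem symVec_mul_mem_symLower {n : ℕ} (x : U) {m : SymCrossed ρ ψ} (hm : m ∈ symLower ρ ψ n) :
    symVec ρ ψ x * m ∈ symLower ρ ψ (n + 1) :=
  symLower_le (V := (symLower ρ ψ (n + 1)).comap (LinearMap.mulLeft ℂ (symVec ρ ψ x)))
    (fun _ hk _ hm => symPart_le_symLower (Nat.succ_lt_succ hk) (symVec_mul_mem x hm)) hm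

theorem of_mul_mem_symLower {n : ℕ} (g : G) {m : SymCrossed ρ ψ} (hm : m ∈ symLower ρ ψ n) :
    of (symAction ρ) ψ g * m ∈ symLower ρ ψ n :=
  symLower_le (V := (symLower ρ ψ n).comap (LinearMap.mulLeft ℂ (of (symAction ρ) ψ g)))
    (fun _ hk _ hm => symPart_le_symLower hk (of_mul_mem g hm)) hm

theorem mem_iSup_symPart (m : SymCrossed ρ ψ) : m ∈ ⨆ n, symPart ρ ψ n := by
  rw [← sum_single m]
  refine Submodule.sum_mem _ fun g _ => ?_
  have h : ⨆ n, symDegree U n ≤ (⨆ n, symPart ρ ψ n).comap (singleₗ (symAction ρ) ψ g) :=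
    iSup_le fun n a ha => Submodule.mem_iSup_of_mem n (single_mem g ha)
  exact h (mem_iSup_symDegree (m g))

theorem exists_mem_symLower (m : SymCrossed ρ ψ) : ∃ n, m ∈ symLower ρ ψ n := by
  refine Submodule.iSup_induction _ (motive := fun m => ∃ n, m ∈ symLower ρ ψ n)
    (mem_iSup_symPart m) ?_ ?_ ?_
  · exact fun n m hm => ⟨n + 1, symPart_le_symLower n.lt_succ_self hm⟩
  · exact ⟨0, zero_mem _⟩
  · rintro m m' ⟨n, hm⟩ ⟨n', hm'⟩
    exact ⟨max n n', add_mem (symLower_mono (le_max_left _ _) hm)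
      (symLower_mono (le_max_right _ _) hm')⟩

theorem eq_zero_of_mem_symLower {n : ℕ} {m : SymCrossed ρ ψ} (hm : m ∈ symPart ρ ψ n)
    (h : m ∈ symLower ρ ψ n) : m = 0 := by
  ext g
  refine eq_zero_of_mem_of_mem_iSup (hm g) ?_
  exact symLower_le (V := (⨆ k : Fin n, symDegree U k).comap (coeffₗ (symAction ρ) ψ g))
    (fun k hk _ hm => Submodule.mem_iSup_of_mem ⟨k, hk⟩ (hm g)) h

variable (ρ ψ) in
/-- The linear map of `SU ⋊ ℂ_ψ G` that divides the elements of degree `n` by `n + 1`. -/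
def weight : Module.End ℂ (SymCrossed ρ ψ) where
  toFun m := fun g => symWeight U (m g)
  map_add' m m' := by ext g; exact map_add (symWeight U) (m g) (m' g)
  map_smul' r m := by ext g; exact map_smul (symWeight U) r (m g)

theorem weight_of_mem {n : ℕ} {m : SymCrossed ρ ψ} (hm : m ∈ symPart ρ ψ n) :
    weight ρ ψ m = (n + 1 : ℂ)⁻¹ • m := by
  ext g
  exact symWeight_of_mem (hm g)

theorem weight_mem_symLower {n : ℕ} {m : SymCrossed ρ ψ} (hm : m ∈ symLower ρ ψ n) :
    weight ρ ψ m ∈ symLower ρ ψ n := by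
  refine symLower_le (V := (symLower ρ ψ n).comap (weight ρ ψ)) (fun k hk m hm => ?_) hm
  rw [Submodule.mem_comap, weight_of_mem hm]
  exact Submodule.smul_mem _ _ (symPart_le_symLower hk hm)

/-! ### Contraction with the universal derivation -/

variable (ρ ψ) in
/-- For a family of operators `φ y`, depending linearly on a vector `y`, the operator that sends
`y₁ ⋯ yₙ ⊗ g` to the sum of the `φ yᵢ (y₁ ⋯ ŷᵢ ⋯ yₙ ⊗ g)`. -/
def contract : (U →ₗ[ℂ] Module.End ℂ (SymCrossed ρ ψ)) →ₗ[ℂ] Module.End ℂ (SymCrossed ρ ψ) where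
  toFun φ := ∑ g : G, TensorProduct.lift (φ.flip ∘ₗ singleₗ (symAction ρ) ψ g)
    ∘ₗ symDeriv U ∘ₗ coeffₗ (symAction ρ) ψ g
  map_add' φ φ' := by
    rw [← Finset.sum_add_distrib]
    refine Finset.sum_congr rfl fun g _ => ?_
    rw [← LinearMap.add_comp]
    congr 1
    ext
    rfl
  map_smul' r φ := by
    rw [RingHom.id_apply, Finset.smul_sum]
    refine Finset.sum_congr rfl fun g _ => ?_
    rw [← LinearMap.smul_comp]
    congr 1
    ext
    rfl

theorem contract_apply (φ : U →ₗ[ℂ] Module.End ℂ (SymCrossed ρ ψ)) (m : SymCrossed ρ ψ) :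
    contract ρ ψ φ m = ∑ g : G, TensorProduct.lift (φ.flip ∘ₗ singleₗ (symAction ρ) ψ g)
      (symDeriv U (m g)) := by
  simp only [contract, LinearMap.coe_mk, AddHom.coe_mk, LinearMap.sum_apply, LinearMap.comp_apply]
  rfl

/-- The Leibniz rule. -/
theorem contract_symVec_mul (φ : U →ₗ[ℂ] Module.End ℂ (SymCrossed ρ ψ)) (x : U)
    (m : SymCrossed ρ ψ) :
    contract ρ ψ φ (symVec ρ ψ x * m)
      = φ x m + contract ρ ψ (φ.compl₂ (LinearMap.mulLeft ℂ (symVec ρ ψ x))) m := by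
  have h : ∀ g t, TensorProduct.lift (φ.flip ∘ₗ singleₗ (symAction ρ) ψ g)
      ((LinearMap.mulLeft ℂ (SymmetricAlgebra.ι ℂ U x)).rTensor U t)
      = TensorProduct.lift ((φ.compl₂ (LinearMap.mulLeft ℂ (symVec ρ ψ x))).flip
        ∘ₗ singleₗ (symAction ρ) ψ g) t := fun g t => by
    induction t using TensorProduct.induction_on with
    | zero => simp
    | add s t hs ht => simp only [map_add, hs, ht]
    | tmul a y =>
      simp only [LinearMap.rTensor_tmul, TensorProduct.lift.tmul, LinearMap.comp_apply,
        LinearMap.flip_apply, LinearMap.compl₂_apply, LinearMap.mulLeft_apply]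
      exact congrArg (φ y) (symVec_mul_single x g a).symm
  simp only [contract_apply, symVec_mul_apply, symDeriv_ι_mul, map_add, h, Finset.sum_add_distrib]
  congr 1
  conv_rhs => rw [← sum_single m, map_sum]
  rfl

theorem contract_of_mem_zero (φ : U →ₗ[ℂ] Module.End ℂ (SymCrossed ρ ψ)) {m : SymCrossed ρ ψ}
    (hm : m ∈ symPart ρ ψ 0) : contract ρ ψ φ m = 0 := by
  rw [contract_apply]
  refine Finset.sum_eq_zero fun g _ => ?_
  have hg := hm g
  rw [pow_zero, Submodule.mem_one] at hg
  obtain ⟨r, hr⟩ := hg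
  rw [← hr, Algebra.algebraMap_eq_smul_one, map_smul, symDeriv_one, smul_zero, map_zero]

theorem contract_mem {n : ℕ} {V : Submodule ℂ (SymCrossed ρ ψ)}
    {φ : U →ₗ[ℂ] Module.End ℂ (SymCrossed ρ ψ)} (h : ∀ y, ∀ m ∈ symPart ρ ψ n, φ y m ∈ V)
    {m : SymCrossed ρ ψ} (hm : m ∈ symPart ρ ψ (n + 1)) : contract ρ ψ φ m ∈ V := by
  induction n generalizing φ m with
  | zero =>
    refine symPart_succ_le (V := V.comap (contract ρ ψ φ)) (fun x m hm => ?_) hm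
    rw [Submodule.mem_comap, contract_symVec_mul, contract_of_mem_zero _ hm, add_zero]
    exact h x m hm
  | succ n ih =>
    refine symPart_succ_le (V := V.comap (contract ρ ψ φ)) (fun x m hm => ?_) hm
    rw [Submodule.mem_comap, contract_symVec_mul]
    exact add_mem (h x m hm) (ih (fun y m hm => by
      exact h y (symVec ρ ψ x * m) (symVec_mul_mem x hm)) hm)

theorem contract_mem_of_symLower {n : ℕ} {V : Submodule ℂ (SymCrossed ρ ψ)}
    {φ : U →ₗ[ℂ] Module.End ℂ (SymCrossed ρ ψ)} (h : ∀ y, ∀ m ∈ symLower ρ ψ n, φ y m ∈ V)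
    {m : SymCrossed ρ ψ} (hm : m ∈ symLower ρ ψ (n + 1)) : contract ρ ψ φ m ∈ V := by
  refine symLower_le (V := V.comap (contract ρ ψ φ)) (fun k hk m hm => ?_) hm
  rw [Submodule.mem_comap]
  cases k with
  | zero => rw [contract_of_mem_zero _ hm]; exact zero_mem _
  | succ k =>
    exact contract_mem (fun y m hm =>
      h y m (symPart_le_symLower (Nat.lt_of_succ_lt_succ hk) hm)) hm

theorem contract_congr {n : ℕ} {φ φ' : U →ₗ[ℂ] Module.End ℂ (SymCrossed ρ ψ)}
    (h : ∀ y, ∀ m ∈ symPart ρ ψ n, φ y m = φ' y m) {m : SymCrossed ρ ψ}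
    (hm : m ∈ symPart ρ ψ (n + 1)) : contract ρ ψ φ m = contract ρ ψ φ' m := by
  rw [← sub_eq_zero, ← LinearMap.sub_apply, ← map_sub, ← Submodule.mem_bot ℂ]
  exact contract_mem (fun y m hm => sub_eq_zero.mpr (h y m hm)) hm

theorem contract_congr_of_symLower {n : ℕ} {φ φ' : U →ₗ[ℂ] Module.End ℂ (SymCrossed ρ ψ)}
    (h : ∀ y, ∀ m ∈ symLower ρ ψ n, φ y m = φ' y m) {m : SymCrossed ρ ψ}
    (hm : m ∈ symLower ρ ψ (n + 1)) : contract ρ ψ φ m = contract ρ ψ φ' m := by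
  rw [← sub_eq_zero, ← LinearMap.sub_apply, ← map_sub, ← Submodule.mem_bot ℂ]
  exact contract_mem_of_symLower (fun y m hm => sub_eq_zero.mpr (h y m hm)) hm

/-- Contraction is compatible with the action of `G`. -/
theorem of_mul_contract {n : ℕ} (g : G) {φ φ' : U →ₗ[ℂ] Module.End ℂ (SymCrossed ρ ψ)}
    (h : ∀ y, ∀ m ∈ symPart ρ ψ n, of (symAction ρ) ψ g * φ y m
      = φ' (ρ g y) (of (symAction ρ) ψ g * m)) {m : SymCrossed ρ ψ}
    (hm : m ∈ symPart ρ ψ (n + 1)) :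
    of (symAction ρ) ψ g * contract ρ ψ φ m = contract ρ ψ φ' (of (symAction ρ) ψ g * m) := by
  have hx : ∀ x (m : SymCrossed ρ ψ), of (symAction ρ) ψ g * (symVec ρ ψ x * m)
      = symVec ρ ψ (ρ g x) * (of (symAction ρ) ψ g * m) := fun x m => by
    rw [← mul_assoc, of_mul_symVec, mul_assoc]
  induction n generalizing φ φ' m with
  | zero =>
    refine symPart_succ_le (V := LinearMap.eqLocus
      (LinearMap.mulLeft ℂ (of (symAction ρ) ψ g) * contract ρ ψ φ)
      (contract ρ ψ φ' * LinearMap.mulLeft ℂ (of (symAction ρ) ψ g))) (fun x m hm => ?_) hm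
    simp only [LinearMap.mem_eqLocus, Module.End.mul_apply, LinearMap.mulLeft_apply]
    rw [hx, contract_symVec_mul, contract_symVec_mul, contract_of_mem_zero _ hm,
      contract_of_mem_zero _ (of_mul_mem g hm), add_zero, add_zero, h x m hm]
  | succ n ih =>
    refine symPart_succ_le (V := LinearMap.eqLocus
      (LinearMap.mulLeft ℂ (of (symAction ρ) ψ g) * contract ρ ψ φ)
      (contract ρ ψ φ' * LinearMap.mulLeft ℂ (of (symAction ρ) ψ g))) (fun x m hm => ?_) hm
    simp only [LinearMap.mem_eqLocus, Module.End.mul_apply, LinearMap.mulLeft_apply]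
    rw [hx, contract_symVec_mul, contract_symVec_mul, mul_add, h x m hm]
    congr 1
    refine ih (fun y m hm => ?_) hm
    simp only [LinearMap.compl₂_apply, LinearMap.mulLeft_apply]
    rw [h y _ (symVec_mul_mem x hm), hx]

/-- Euler's identity. -/
theorem contract_euler {n : ℕ} (η : Module.End ℂ (SymCrossed ρ ψ))
    {φ : U →ₗ[ℂ] Module.End ℂ (SymCrossed ρ ψ)} (h : ∀ y m, φ y m = η (symVec ρ ψ y * m))
    {m : SymCrossed ρ ψ} (hm : m ∈ symPart ρ ψ n) : contract ρ ψ φ m = (n : ℂ) • η m := by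
  induction n generalizing φ η m with
  | zero => rw [contract_of_mem_zero _ hm, Nat.cast_zero, zero_smul]
  | succ n ih =>
    refine symPart_succ_le (V := LinearMap.eqLocus (contract ρ ψ φ) (((n + 1 : ℕ) : ℂ) • η))
      (fun x m hm => ?_) hm
    rw [LinearMap.mem_eqLocus, contract_symVec_mul, h,
      ih (η * LinearMap.mulLeft ℂ (symVec ρ ψ x)) (fun y m => ?_) hm]
    · simp only [Module.End.mul_apply, LinearMap.mulLeft_apply, LinearMap.smul_apply]
      push_cast
      module
    · simp only [LinearMap.compl₂_apply, LinearMap.mulLeft_apply, Module.End.mul_apply]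
      rw [h, symVec_mul_comm]

/-- Exactness of the Koszul complex of `SU` at `Λ²U ⊗ SU`, by the Euler homotopy: a two-cocycle
`Φ` of degree `n` is, up to the factor `n + 2`, the coboundary of `x ↦ contract (Φ x)`. -/
theorem contract_koszul {n : ℕ} {Φ : U →ₗ[ℂ] U →ₗ[ℂ] Module.End ℂ (SymCrossed ρ ψ)}
    (hskew : ∀ x y m, Φ x y m = - Φ y x m)
    (hcyc : ∀ k, k + 1 = n → ∀ x y z, ∀ m ∈ symPart ρ ψ k,
      Φ x y (symVec ρ ψ z * m) + Φ y z (symVec ρ ψ x * m) + Φ z x (symVec ρ ψ y * m) = 0)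
    (x y : U) {m : SymCrossed ρ ψ} (hm : m ∈ symPart ρ ψ n) :
    contract ρ ψ (Φ x) (symVec ρ ψ y * m) - contract ρ ψ (Φ y) (symVec ρ ψ x * m)
      = (n + 2 : ℂ) • Φ x y m := by
  rw [contract_symVec_mul, contract_symVec_mul, hskew y x]
  have h : contract ρ ψ ((Φ x).compl₂ (LinearMap.mulLeft ℂ (symVec ρ ψ y))) m
      - contract ρ ψ ((Φ y).compl₂ (LinearMap.mulLeft ℂ (symVec ρ ψ x))) m
      = (n : ℂ) • Φ x y m := by
    rw [← LinearMap.sub_apply, ← map_sub]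
    cases n with
    | zero => rw [contract_of_mem_zero _ hm, Nat.cast_zero, zero_smul]
    | succ n =>
      let φ : U →ₗ[ℂ] Module.End ℂ (SymCrossed ρ ψ) :=
        ((LinearMap.mul ℂ (SymCrossed ρ ψ)) ∘ₗ symVec ρ ψ).compr₂ (Φ x y)
      have hφ : ∀ z m, φ z m = Φ x y (symVec ρ ψ z * m) := fun z m => rfl
      rw [← contract_euler (Φ x y) hφ hm]
      refine contract_congr (fun z m hm => ?_) hm
      have hc := hcyc n rfl x y z m hm
      rw [hskew z x] at hc
      rw [hφ, ← sub_eq_zero, ← neg_eq_zero, ← hc]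
      simp only [LinearMap.sub_apply, LinearMap.compl₂_apply, LinearMap.mulLeft_apply]
      abel
  rw [add_smul, ← h, two_smul]
  abel

end SymCrossed

/-! ### Vectors as operators on the crossed product with the symmetric algebra -/

section Operators

variable {G : Type u} [Group G] [Fintype G] {U : Type v} [AddCommGroup U] [Module ℂ U]
  {ρ : Representation ℂ G U} {ω : LinearMap.BilinForm ℂ U} {ψ : TwoCocycle G}
  {c : regularReflections ρ ω ψ → ℂ}

theorem kappa_mul_mem {n : ℕ} (x y : U) {m : SymCrossed ρ ψ} (hm : m ∈ symLower ρ ψ n) :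
    kappa (symAction ρ) ρ ω ψ c x y * m ∈ symLower ρ ψ n := by
  classical
  rw [kappa_apply, add_mul, smul_mul_assoc, one_mul, Finset.sum_mul]
  refine add_mem (Submodule.smul_mem _ _ hm) (Submodule.sum_mem _ fun s _ => ?_)
  rw [smul_mul_assoc]
  exact Submodule.smul_mem _ _ (of_mul_mem_symLower _ hm)

/-- The operator by which a vector `x` acts, for a correction term `θ x`. -/
def vecOp (θ : U →ₗ[ℂ] Module.End ℂ (SymCrossed ρ ψ)) : U →ₗ[ℂ] Module.End ℂ (SymCrossed ρ ψ) :=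
  LinearMap.mul ℂ (SymCrossed ρ ψ) ∘ₗ symVec ρ ψ + θ

theorem vecOp_apply (θ : U →ₗ[ℂ] Module.End ℂ (SymCrossed ρ ψ)) (x : U) (m : SymCrossed ρ ψ) :
    vecOp θ x m = symVec ρ ψ x * m + θ x m := rfl

variable (c) in
/-- The operator to which `θ(x, y m) - θ(y, x m)` has to be equal, for the operators `vecOp θ`
to have the commutators prescribed by the commutator form. -/
def defect (θ : U →ₗ[ℂ] Module.End ℂ (SymCrossed ρ ψ)) :
    U →ₗ[ℂ] U →ₗ[ℂ] Module.End ℂ (SymCrossed ρ ψ) :=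
  LinearMap.mk₂ ℂ (fun x y => LinearMap.mul ℂ (SymCrossed ρ ψ) (kappa (symAction ρ) ρ ω ψ c y x)
      - vecOp θ x * θ y + vecOp θ y * θ x)
    (fun x x' y => by simp only [map_add, mul_add, add_mul]; abel)
    (fun r x y => by
      simp only [map_smul, mul_smul_comm, smul_mul_assoc, smul_add, smul_sub])
    (fun x y y' => by simp only [map_add, mul_add, add_mul, LinearMap.add_apply]; abel)
    (fun r x y => by
      simp only [map_smul, mul_smul_comm, smul_mul_assoc, smul_add, smul_sub,
        LinearMap.smul_apply])

theorem defect_apply (θ : U →ₗ[ℂ] Module.End ℂ (SymCrossed ρ ψ)) (x y : U)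
    (m : SymCrossed ρ ψ) : defect c θ x y m
      = kappa (symAction ρ) ρ ω ψ c y x * m - vecOp θ x (θ y m) + vecOp θ y (θ x m) := rfl

variable (c) in
/-- One step of the recursion that determines the correction term: `θ` is replaced by the
Koszul homotopy applied to its defect. In degree `n + 1` the factor `weight` is `(n + 2)⁻¹`, the
inverse of the factor in `contract_koszul`. -/
def nextCorrection (θ : U →ₗ[ℂ] Module.End ℂ (SymCrossed ρ ψ)) :
    U →ₗ[ℂ] Module.End ℂ (SymCrossed ρ ψ) :=
  LinearMap.mulRight ℂ (weight ρ ψ) ∘ₗ contract ρ ψ ∘ₗ defect c θ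

theorem nextCorrection_apply (θ : U →ₗ[ℂ] Module.End ℂ (SymCrossed ρ ψ)) (x : U)
    (m : SymCrossed ρ ψ) :
    nextCorrection c θ x m = contract ρ ψ (defect c θ x) (weight ρ ψ m) := rfl

/-- The operators `θ x` lower the degree. -/
def Lowers (θ : U →ₗ[ℂ] Module.End ℂ (SymCrossed ρ ψ)) : Prop :=
  ∀ n x, ∀ m ∈ symLower ρ ψ (n + 1), θ x m ∈ symLower ρ ψ n

theorem Lowers.mem {θ : U →ₗ[ℂ] Module.End ℂ (SymCrossed ρ ψ)} (hθ : Lowers θ) {n : ℕ} (x : U)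
    {m : SymCrossed ρ ψ} (hm : m ∈ symLower ρ ψ n) : θ x m ∈ symLower ρ ψ n :=
  hθ n x m (symLower_mono n.le_succ hm)

theorem Lowers.vecOp_mem {θ : U →ₗ[ℂ] Module.End ℂ (SymCrossed ρ ψ)} (hθ : Lowers θ) {n : ℕ}
    (x : U) {m : SymCrossed ρ ψ} (hm : m ∈ symLower ρ ψ n) :
    vecOp θ x m ∈ symLower ρ ψ (n + 1) :=
  add_mem (symVec_mul_mem_symLower x hm) (symLower_mono n.le_succ (hθ.mem x hm))

theorem Lowers.vecOp_comp_mem {θ θ' : U →ₗ[ℂ] Module.End ℂ (SymCrossed ρ ψ)} (hθ : Lowers θ)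
    (hθ' : Lowers θ') {n : ℕ} (x y : U) {m : SymCrossed ρ ψ} (hm : m ∈ symLower ρ ψ n) :
    vecOp θ x (θ' y m) ∈ symLower ρ ψ n := by
  cases n with
  | zero =>
    rw [symLower_zero, Submodule.mem_bot] at hm
    rw [hm, map_zero, map_zero]
    exact zero_mem _
  | succ n => exact hθ.vecOp_mem x (hθ' n y m hm)

theorem Lowers.nextCorrection {θ : U →ₗ[ℂ] Module.End ℂ (SymCrossed ρ ψ)} (hθ : Lowers θ) :
    Lowers (nextCorrection c θ) := fun _ x _ hm =>
  contract_mem_of_symLower (fun y _ hm => add_mem (sub_mem (kappa_mul_mem y x hm)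
    (hθ.vecOp_comp_mem hθ x y hm)) (hθ.vecOp_comp_mem hθ y x hm)) (weight_mem_symLower hm)

theorem nextCorrection_congr {θ θ' : U →ₗ[ℂ] Module.End ℂ (SymCrossed ρ ψ)} (hθ : Lowers θ)
    {n : ℕ} (h : ∀ x, ∀ m ∈ symLower ρ ψ n, θ x m = θ' x m) (x : U)
    {m : SymCrossed ρ ψ} (hm : m ∈ symLower ρ ψ (n + 1)) :
    nextCorrection c θ x m = nextCorrection c θ' x m := by
  have h' : ∀ x y, ∀ m ∈ symLower ρ ψ n, vecOp θ x (θ y m) = vecOp θ' x (θ' y m) := by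
    intro x y m hm
    rw [vecOp_apply, vecOp_apply, ← h y m hm, h x _ (hθ.mem y hm)]
  refine contract_congr_of_symLower (fun y m hm => ?_) (weight_mem_symLower hm)
  rw [defect_apply, defect_apply, h' x y m hm, h' y x m hm]

variable (c) in
/-- The approximations to the correction term; the `n`-th one is correct in degrees less
than `n`. -/
def approxCorrection (n : ℕ) : U →ₗ[ℂ] Module.End ℂ (SymCrossed ρ ψ) := (nextCorrection c)^[n] 0

theorem approxCorrection_succ (n : ℕ) :
    approxCorrection c (n + 1) = nextCorrection c (approxCorrection c n) :=
  Function.iterate_succ_apply' _ _ _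

theorem lowers_approxCorrection (n : ℕ) : Lowers (approxCorrection c n) := by
  induction n with
  | zero => exact fun _ _ _ _ => zero_mem _
  | succ n ih => rw [approxCorrection_succ]; exact ih.nextCorrection

theorem approxCorrection_succ_apply {n : ℕ} (x : U) {m : SymCrossed ρ ψ}
    (hm : m ∈ symLower ρ ψ n) :
    approxCorrection c (n + 1) x m = approxCorrection c n x m := by
  induction n generalizing x m with
  | zero =>
    rw [symLower_zero, Submodule.mem_bot] at hm
    rw [hm, map_zero, map_zero]
  | succ n ih =>
    have h := nextCorrection_congr (c := c) (lowers_approxCorrection (n + 1))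
      (fun x m hm => ih x hm) x hm
    rwa [← approxCorrection_succ, ← approxCorrection_succ] at h

theorem approxCorrection_apply_of_le {k n : ℕ} (hkn : k ≤ n) (x : U) {m : SymCrossed ρ ψ}
    (hm : m ∈ symLower ρ ψ k) : approxCorrection c n x m = approxCorrection c k x m := by
  induction n, hkn using Nat.le_induction with
  | base => rfl
  | succ n hkn ih => rw [approxCorrection_succ_apply x (symLower_mono hkn hm), ih]

theorem approxCorrection_apply_eq {k n : ℕ} (x : U) {m : SymCrossed ρ ψ}
    (hk : m ∈ symLower ρ ψ k) (hn : m ∈ symLower ρ ψ n) :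
    approxCorrection c k x m = approxCorrection c n x m := by
  rcases le_total k n with h | h
  · exact (approxCorrection_apply_of_le h x hk).symm
  · exact approxCorrection_apply_of_le h x hn

/-- The approximations are compatible: on elements of degree less than `n`, all of them from the
`n`-th on agree, so they have a common limit. -/
theorem exists_correction (c : regularReflections ρ ω ψ → ℂ) :
    ∃ θ : U →ₗ[ℂ] Module.End ℂ (SymCrossed ρ ψ),
      ∀ n x, ∀ m ∈ symLower ρ ψ n, θ x m = approxCorrection c n x m := by
  choose N hN using exists_mem_symLower (ρ := ρ) (ψ := ψ)
  have key : ∀ n x, ∀ m ∈ symLower ρ ψ n,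
      approxCorrection c (N m) x m = approxCorrection c n x m :=
    fun n x m hm => approxCorrection_apply_eq x (hN m) hm
  refine ⟨LinearMap.mk₂ ℂ (fun x m => approxCorrection c (N m) x m) ?_ ?_ ?_ ?_, key⟩
  · intro x x' m
    rw [map_add, LinearMap.add_apply]
  · intro r x m
    rw [map_smul, LinearMap.smul_apply]
  · intro x m m'
    have h := symLower_mono (le_max_left (N m) (N m')) (hN m)
    have h' := symLower_mono (le_max_right (N m) (N m')) (hN m')
    rw [key _ x _ (add_mem h h'), key _ x _ h, key _ x _ h', map_add]
  · intro r x m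
    rw [key _ x _ (Submodule.smul_mem _ r (hN m)), map_smul]

variable (c) in
/-- The correction term: the fixed point of `nextCorrection`. -/
def correction : U →ₗ[ℂ] Module.End ℂ (SymCrossed ρ ψ) := (exists_correction c).choose

theorem correction_apply {n : ℕ} (x : U) {m : SymCrossed ρ ψ} (hm : m ∈ symLower ρ ψ n) :
    correction c x m = approxCorrection c n x m := (exists_correction c).choose_spec n x m hm

theorem lowers_correction : Lowers (correction c) := fun n x m hm => by
  rw [correction_apply x hm]
  exact lowers_approxCorrection _ n x m hm

theorem nextCorrection_correction : nextCorrection c (correction c) = correction c := by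
  ext x m : 2
  obtain ⟨n, hn⟩ := exists_mem_symLower m
  have hn' := symLower_mono n.le_succ hn
  rw [correction_apply x hn', Nat.succ_eq_add_one, approxCorrection_succ]
  exact nextCorrection_congr lowers_correction (fun x m hm => correction_apply x hm) x hn'

theorem correction_of_mem {n : ℕ} (x : U) {m : SymCrossed ρ ψ} (hm : m ∈ symPart ρ ψ n) :
    correction c x m = (n + 1 : ℂ)⁻¹ • contract ρ ψ (defect c (correction c) x) m := by
  conv_lhs => rw [← nextCorrection_correction, nextCorrection_apply, weight_of_mem hm, map_smul]

theorem of_mul_vecOp (g : G) {θ : U →ₗ[ℂ] Module.End ℂ (SymCrossed ρ ψ)} {x : U}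
    {m : SymCrossed ρ ψ} (h : of (symAction ρ) ψ g * θ x m
      = θ (ρ g x) (of (symAction ρ) ψ g * m)) :
    of (symAction ρ) ψ g * vecOp θ x m = vecOp θ (ρ g x) (of (symAction ρ) ψ g * m) := by
  rw [vecOp_apply, vecOp_apply, mul_add, h, ← mul_assoc, of_mul_symVec, mul_assoc]

variable (c) in
/-- The identity expressing that `κ` is equivariant. -/
def IsEquivariantForm : Prop := ∀ (g : G) (x y : U),
  of (symAction ρ) ψ g * kappa (symAction ρ) ρ ω ψ c x y
    = kappa (symAction ρ) ρ ω ψ c (ρ g x) (ρ g y) * of (symAction ρ) ψ g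

theorem of_mul_correction (hκ : IsEquivariantForm c) (g : G) (x : U) (m : SymCrossed ρ ψ) :
    of (symAction ρ) ψ g * correction c x m
      = correction c (ρ g x) (of (symAction ρ) ψ g * m) := by
  obtain ⟨n, hn⟩ := exists_mem_symLower m
  induction n generalizing x m with
  | zero =>
    rw [symLower_zero, Submodule.mem_bot] at hn
    rw [hn, mul_zero, map_zero, map_zero, mul_zero]
  | succ n ih =>
    refine symLower_le (V := LinearMap.eqLocus
      (LinearMap.mulLeft ℂ (of (symAction ρ) ψ g) * correction c x)
      (correction c (ρ g x) * LinearMap.mulLeft ℂ (of (symAction ρ) ψ g)))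
      (fun k hk m hm => ?_) hn
    simp only [LinearMap.mem_eqLocus, Module.End.mul_apply, LinearMap.mulLeft_apply]
    rw [correction_of_mem x hm, correction_of_mem _ (of_mul_mem g hm), mul_smul_comm]
    congr 1
    cases k with
    | zero => rw [contract_of_mem_zero _ hm, contract_of_mem_zero _ (of_mul_mem g hm), mul_zero]
    | succ k =>
      refine of_mul_contract g (fun y m hm => ?_) hm
      have hm' : m ∈ symLower ρ ψ n := symPart_le_symLower (Nat.lt_of_succ_lt_succ hk) hm
      have h : ∀ x y, of (symAction ρ) ψ g * vecOp (correction c) x (correction c y m)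
          = vecOp (correction c) (ρ g x) (correction c (ρ g y) (of (symAction ρ) ψ g * m)) :=
        fun x y => by
          rw [of_mul_vecOp g (ih x _ (lowers_correction.mem y hm')), ih y m hm']
      rw [defect_apply, defect_apply, mul_add, mul_sub, h, h, ← mul_assoc, hκ, mul_assoc]

theorem of_mul_vecOp_correction (hκ : IsEquivariantForm c) (g : G) (x : U)
    (m : SymCrossed ρ ψ) :
    of (symAction ρ) ψ g * vecOp (correction c) x m
      = vecOp (correction c) (ρ g x) (of (symAction ρ) ψ g * m) :=
  of_mul_vecOp g (of_mul_correction hκ g x m)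

/-- The Jacobi identity: the commutators of the commutator form with the vectors have vanishing
cyclic sum. -/
theorem kappa_jacobi (hω : ω.IsAlt) (hκ : IsEquivariantForm c) (x y z : U)
    (m : SymCrossed ρ ψ) :
    (kappa (symAction ρ) ρ ω ψ c x y * vecOp (correction c) z m
        - vecOp (correction c) z (kappa (symAction ρ) ρ ω ψ c x y * m))
      + (kappa (symAction ρ) ρ ω ψ c y z * vecOp (correction c) x m
        - vecOp (correction c) x (kappa (symAction ρ) ρ ω ψ c y z * m))
      + (kappa (symAction ρ) ρ ω ψ c z x * vecOp (correction c) y m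
        - vecOp (correction c) y (kappa (symAction ρ) ρ ω ψ c z x * m)) = 0 := by
  classical
  have h : ∀ x y z, kappa (symAction ρ) ρ ω ψ c x y * vecOp (correction c) z m
        - vecOp (correction c) z (kappa (symAction ρ) ρ ω ψ c x y * m)
      = ∑ s : regularReflections ρ ω ψ, c s • vecOp (correction c)
          (reflectionForm ρ ω s x y • (ρ s z - z)) (of (symAction ρ) ψ s * m) := fun x y z => by
    simp only [kappa_apply, add_mul, Finset.sum_mul, smul_mul_assoc, one_mul, map_add, map_smul,
      map_sum, of_mul_vecOp_correction hκ, map_sub, LinearMap.sub_apply, LinearMap.smul_apply,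
      smul_smul, smul_sub, Finset.sum_sub_distrib]
    abel
  rw [h, h, h, ← Finset.sum_add_distrib, ← Finset.sum_add_distrib]
  refine Finset.sum_eq_zero fun s _ => ?_
  rw [← smul_add, ← smul_add, ← LinearMap.add_apply, ← map_add, ← LinearMap.add_apply, ← map_add,
    reflectionForm_cyclic hω s.2.1.2, map_zero, LinearMap.zero_apply, smul_zero]

/-- The commutation relation, restated as the equation that the correction term has to solve. -/
theorem vecOp_comm_iff (x y : U) (m : SymCrossed ρ ψ) :
    vecOp (correction c) x (vecOp (correction c) y m)
        - vecOp (correction c) y (vecOp (correction c) x m)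
        = kappa (symAction ρ) ρ ω ψ c y x * m
      ↔ correction c x (symVec ρ ψ y * m) - correction c y (symVec ρ ψ x * m)
        = defect c (correction c) x y m := by
  rw [defect_apply, ← sub_eq_zero, ← sub_eq_zero (b := _ + _)]
  refine Eq.congr_left ?_
  simp only [vecOp_apply, map_add]
  rw [symVec_mul_comm x y]
  abel

/-- The operators `vecOp` satisfy the commutation relations of the twisted symplectic reflection
algebra. By induction on the degree, the defect of the correction term is a Koszul cocycle, as a
consequence of the Jacobi identity. -/
theorem vecOp_comm (hω : ω.IsAlt) (hκ : IsEquivariantForm c) (x y : U) (m : SymCrossed ρ ψ) :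
    vecOp (correction c) x (vecOp (correction c) y m)
        - vecOp (correction c) y (vecOp (correction c) x m)
      = kappa (symAction ρ) ρ ω ψ c y x * m := by
  obtain ⟨n, hn⟩ := exists_mem_symLower m
  induction n generalizing x y m with
  | zero =>
    rw [symLower_zero, Submodule.mem_bot] at hn
    simp only [hn, map_zero, mul_zero, sub_zero]
  | succ n ih =>
    refine symLower_le (V := LinearMap.eqLocus
      (vecOp (correction c) x * vecOp (correction c) y
        - vecOp (correction c) y * vecOp (correction c) x)
      (LinearMap.mulLeft ℂ (kappa (symAction ρ) ρ ω ψ c y x))) (fun k hk m hm => ?_) hn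
    refine (vecOp_comm_iff x y m).mpr ?_
    have hskew : ∀ x y m, defect c (correction c) x y m = - defect c (correction c) y x m := by
      intro x y m
      rw [defect_apply, defect_apply, kappa_swap _ hω y x, neg_mul]
      abel
    have hcyc : ∀ i, i + 1 = k → ∀ x y z, ∀ m ∈ symPart ρ ψ i,
        defect c (correction c) x y (symVec ρ ψ z * m)
          + defect c (correction c) y z (symVec ρ ψ x * m)
          + defect c (correction c) z x (symVec ρ ψ y * m) = 0 := by
      intro i hi x y z m hm
      have hm' : m ∈ symLower ρ ψ n := symPart_le_symLower (by omega) hm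
      -- the commutation relation on `m` and on `θ(z, m)`, both of smaller degree
      have h1 : ∀ x y, correction c x (symVec ρ ψ y * m)
          = correction c y (symVec ρ ψ x * m) + defect c (correction c) x y m := fun x y => by
        rw [← (vecOp_comm_iff x y m).mp (ih x y m hm'), add_sub_cancel]
      have h2 : ∀ x y z, vecOp (correction c) x (vecOp (correction c) y (correction c z m))
          = vecOp (correction c) y (vecOp (correction c) x (correction c z m))
            + kappa (symAction ρ) ρ ω ψ c y x * correction c z m := fun x y z => by
        rw [← ih x y _ (lowers_correction.mem z hm'), add_sub_cancel]
      have h3 := kappa_jacobi hω hκ y x z m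
      simp only [vecOp_apply _ _ m, mul_add] at h3
      rw [← h3]
      rw [defect_apply _ x y, defect_apply _ y z, defect_apply _ z x, h1 x y, h1 y z, h1 z x]
      simp only [map_add, map_sub, defect_apply]
      rw [h2 x y z, h2 y z x, h2 z x y]
      abel
    have hk := contract_koszul hskew hcyc x y hm
    rw [correction_of_mem _ (symVec_mul_mem y hm), correction_of_mem _ (symVec_mul_mem x hm),
      ← smul_sub, hk, smul_smul]
    have h0 : (k : ℂ) + 2 ≠ 0 := by exact_mod_cast (by omega : k + 2 ≠ 0)
    have e : ((k + 1 : ℕ) + 1 : ℂ) = k + 2 := by push_cast; ring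
    rw [e, inv_mul_cancel₀ h0, one_smul]

end Operators

/-! ### The representation of the reflection algebra on `SU ⋊ ℂ_ψ G` -/

section Representation

variable {G : Type u} [Group G] [Fintype G] {U : Type v} [AddCommGroup U] [Module ℂ U]
  {ρ : Representation ℂ G U} {ω : LinearMap.BilinForm ℂ U} {ψ : TwoCocycle G}
  {c : regularReflections ρ ω ψ → ℂ}

variable (c) in
/-- The action of the tensor algebra on `SU ⋊ ℂ_ψ G` by products of the operators of vectors. -/
def tensorOp : TensorAlgebra ℂ U →ₐ[ℂ] Module.End ℂ (SymCrossed ρ ψ) :=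
  TensorAlgebra.lift ℂ (vecOp (correction c))

theorem tensorOp_ι (x : U) : tensorOp c (TensorAlgebra.ι ℂ x) = vecOp (correction c) x :=
  TensorAlgebra.lift_ι_apply _ _

theorem lmul_of_mul_tensorOp (hκ : IsEquivariantForm c) (g : G) (a : TensorAlgebra ℂ U) :
    Algebra.lmul ℂ (SymCrossed ρ ψ) (of (symAction ρ) ψ g) * tensorOp c a
      = tensorOp c (tensorAction ρ g a)
        * Algebra.lmul ℂ (SymCrossed ρ ψ) (of (symAction ρ) ψ g) := by
  induction a using TensorAlgebra.induction with
  | algebraMap r => simp only [AlgHom.commutes]; exact (Algebra.commutes r _).symm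
  | ι x =>
    rw [tensorAction_ι, tensorOp_ι, tensorOp_ι]
    ext m : 1
    exact of_mul_vecOp_correction hκ g x m
  | mul a b ha hb => rw [map_mul, map_mul, map_mul, ← mul_assoc, ha, mul_assoc, hb, mul_assoc]
  | add a b ha hb => rw [map_add, map_add, map_add, mul_add, ha, hb, add_mul]

/-- The action of `TU ⋊ ℂ_ψ G` on `SU ⋊ ℂ_ψ G`: a vector `x` acts by the operator
`vecOp (correction c) x`, a group element by left multiplication. -/
def crossedOp (hκ : IsEquivariantForm c) :
    TensorCrossed ρ ψ →ₐ[ℂ] Module.End ℂ (SymCrossed ρ ψ) :=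
  lift (tensorOp c) (fun g => Algebra.lmul ℂ (SymCrossed ρ ψ) (of (symAction ρ) ψ g))
    (by rw [of_one, map_smul, map_one])
    (fun g h => by rw [← map_mul, of_mul_of, map_smul])
    (lmul_of_mul_tensorOp hκ)

theorem crossedOp_single (hκ : IsEquivariantForm c) (g : G) (a : TensorAlgebra ℂ U) :
    crossedOp hκ (single (tensorAction ρ) ψ g a)
      = tensorOp c a * Algebra.lmul ℂ (SymCrossed ρ ψ) (of (symAction ρ) ψ g) :=
  lift_single _ _ _ _ _ g a

theorem crossedOp_of (hκ : IsEquivariantForm c) (g : G) :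
    crossedOp hκ (of (tensorAction ρ) ψ g)
      = Algebra.lmul ℂ (SymCrossed ρ ψ) (of (symAction ρ) ψ g) := by
  rw [of, crossedOp_single, map_one, one_mul]

theorem crossedOp_vec (hκ : IsEquivariantForm c) (x : U) :
    crossedOp hκ (vec ρ ψ x) = vecOp (correction c) x := by
  rw [vec, base, crossedOp_single, of_one, Units.smul_def, map_smul, map_smul, map_one, tensorOp_ι,
    smul_mul_smul_comm, mul_one, ← Units.val_mul, inv_mul_cancel, Units.val_one,
    one_smul]

theorem crossedOp_relator (hω : ω.IsAlt) (hκ : IsEquivariantForm c) (x y : U) :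
    crossedOp hκ (relator ρ ω ψ c x y) = 0 := by
  classical
  have h : crossedOp hκ (kappa (tensorAction ρ) ρ ω ψ c x y)
      = Algebra.lmul ℂ (SymCrossed ρ ψ) (kappa (symAction ρ) ρ ω ψ c x y) := by
    simp only [kappa_apply, map_add, map_sum, map_smul, map_one, crossedOp_of]
  rw [relator_eq, map_sub, map_sub, map_mul, map_mul, crossedOp_vec, crossedOp_vec, h,
    sub_eq_zero]
  ext m : 1
  exact vecOp_comm hω hκ y x m

theorem crossedOp_eq_of_toSRA_eq (hω : ω.IsAlt) (hκ : IsEquivariantForm c)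
    {t t' : TensorCrossed ρ ψ} (h : toSRA ρ ω ψ c t = toSRA ρ ω ψ c t') :
    crossedOp hκ t = crossedOp hκ t' := by
  have h1 : relIdeal ρ ω ψ c ≤ TwoSidedIdeal.ker (crossedOp hκ) := by
    refine TwoSidedIdeal.span_le.mpr ?_
    rintro _ ⟨p, rfl⟩
    exact (TwoSidedIdeal.mem_ker _).mpr (crossedOp_relator hω hκ p.1 p.2)
  have h2 : t - t' ∈ relIdeal ρ ω ψ c := (TwoSidedIdeal.rel_iff _ _ _).mp ((RingCon.eq _).mp h)
  rw [← sub_eq_zero, ← map_sub]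
  exact (TwoSidedIdeal.mem_ker _).mp (h1 h2)

/-! ### Leading terms -/

variable (U) in
/-- The part of degree `n` of the tensor algebra. -/
abbrev tensorDegree (n : ℕ) : Submodule ℂ (TensorAlgebra ℂ U) :=
  LinearMap.range (TensorAlgebra.ι ℂ : U →ₗ[ℂ] TensorAlgebra ℂ U) ^ n

theorem tensorDegree_le (n : ℕ) : tensorDegree U n ≤ tensorLE U n :=
  pow_le_pow_left' le_sup_right n

theorem tensorLE_succ_le (n : ℕ) : tensorLE U (n + 1) ≤ tensorLE U n ⊔ tensorDegree U (n + 1) := by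
  induction n with
  | zero => simp [tensorLE, tensorDegree]
  | succ n ih =>
    have h : tensorLE U (n + 1 + 1) = tensorLE U (n + 1)
        ⊔ tensorLE U (n + 1) * LinearMap.range (TensorAlgebra.ι ℂ) := by
      rw [tensorLE, pow_succ, Submodule.mul_sup, mul_one]
      rfl
    rw [h]
    refine sup_le le_sup_left ((mul_le_mul' ih le_rfl).trans ?_)
    rw [Submodule.sup_mul]
    refine sup_le_sup ?_ (pow_succ _ _).ge
    rw [tensorLE, tensorLE, pow_succ]
    exact mul_le_mul' le_rfl le_sup_right

variable (ρ ψ) in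
/-- The projection `TU ⋊ ℂ_ψ G → SU ⋊ ℂ_ψ G`, coefficient by coefficient. -/
def symmetrize (t : TensorCrossed ρ ψ) : SymCrossed ρ ψ :=
  fun g => SymmetricAlgebra.algHom ℂ U (t g)

theorem map_tensorDegree (n : ℕ) :
    (tensorDegree U n).map (SymmetricAlgebra.algHom ℂ U).toLinearMap = symDegree U n := by
  rw [Submodule.map_pow, ← LinearMap.range_comp]
  rfl

theorem algHom_mem {n : ℕ} {a : TensorAlgebra ℂ U} (ha : a ∈ tensorDegree U n) :
    SymmetricAlgebra.algHom ℂ U a ∈ symDegree U n :=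
  (map_tensorDegree n).le ⟨a, ha, rfl⟩

theorem symmetrize_mem {n : ℕ} {t : TensorCrossed ρ ψ}
    (ht : t ∈ coeffIn (tensorAction ρ) ψ (tensorDegree U n)) :
    symmetrize ρ ψ t ∈ symPart ρ ψ n :=
  fun g => algHom_mem (ht g)

theorem exists_symmetrize_eq {n : ℕ} {m : SymCrossed ρ ψ} (hm : m ∈ symPart ρ ψ n) :
    ∃ t ∈ coeffIn (tensorAction ρ) ψ (tensorDegree U n), symmetrize ρ ψ t = m := by
  have h : ∀ g, ∃ a ∈ tensorDegree U n, SymmetricAlgebra.algHom ℂ U a = m g :=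
    fun g => (map_tensorDegree n).ge (hm g)
  choose t ht htm using h
  exact ⟨t, ht, funext htm⟩

theorem tensorOp_of_mem {n : ℕ} (g : G) {a : TensorAlgebra ℂ U} (ha : a ∈ tensorLE U n) :
    tensorOp c a (of (symAction ρ) ψ g) ∈ symLower ρ ψ (n + 1) := by
  have h0 : of (symAction ρ) ψ g ∈ symPart ρ ψ 0 := by
    rw [← mul_one (of (symAction ρ) ψ g)]
    exact of_mul_mem g one_mem_symPart
  induction ha using Submodule.pow_induction_on_left' with
  | algebraMap r =>
    rw [AlgHom.commutes]
    exact Submodule.smul_mem _ r (symPart_le_symLower zero_lt_one h0)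
  | add a b i _ _ ha hb => rw [map_add]; exact add_mem ha hb
  | mem_mul b hb i a _ ha =>
    obtain ⟨_, ⟨r, rfl⟩, _, ⟨x, rfl⟩, rfl⟩ := Submodule.mem_sup.mp hb
    rw [add_mul, map_add, map_mul, map_mul, tensorOp_ι]
    refine add_mem (symLower_mono (Nat.le_succ _) ?_) (lowers_correction.vecOp_mem x ha)
    simp only [LinearMap.toSpanSingleton_apply, map_smul, map_one]
    exact Submodule.smul_mem _ r ha

/-- The leading term of the action of a tensor on a group element is its symmetrization. -/
theorem tensorOp_of_sub_mem {n : ℕ} (g : G) {a : TensorAlgebra ℂ U} (ha : a ∈ tensorDegree U n) :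
    tensorOp c a (of (symAction ρ) ψ g)
      - single (symAction ρ) ψ g (SymmetricAlgebra.algHom ℂ U a) ∈ symLower ρ ψ n := by
  induction ha using Submodule.pow_induction_on_left' with
  | algebraMap r =>
    rw [AlgHom.commutes, AlgHom.commutes, Algebra.algebraMap_eq_smul_one r,
      Algebra.algebraMap_eq_smul_one r, single_smul, LinearMap.smul_apply, Module.End.one_apply, of,
      sub_self]
    exact zero_mem _
  | add a b i _ _ ha hb =>
    rw [map_add, map_add, LinearMap.add_apply, single_add, add_sub_add_comm]
    exact add_mem ha hb
  | mem_mul _ hb i a hai ha =>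
    obtain ⟨x, rfl⟩ := hb
    have hs : single (symAction ρ) ψ g (SymmetricAlgebra.algHom ℂ U a) ∈ symLower ρ ψ (i + 1) :=
      symPart_le_symLower i.lt_succ_self (single_mem g (algHom_mem hai))
    have h1 := lowers_correction (c := c) i x _ hs
    have h2 := (lowers_correction (c := c)).vecOp_mem x ha
    have h3 := add_mem h2 (symLower_mono i.le_succ h1)
    rw [map_sub, vecOp_apply _ _ (single _ _ _ _), symVec_mul_single, sub_add_eq_add_sub,
      add_sub_add_right_eq_sub] at h3
    rw [map_mul, map_mul, tensorOp_ι, Module.End.mul_apply]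
    exact h3

theorem crossedOp_one_eq_sum (hκ : IsEquivariantForm c) (t : TensorCrossed ρ ψ) :
    crossedOp hκ t 1 = ∑ g, tensorOp c (t g) (of (symAction ρ) ψ g) := by
  conv_lhs => rw [← sum_single t]
  rw [map_sum, LinearMap.sum_apply]
  refine Finset.sum_congr rfl fun g _ => ?_
  rw [crossedOp_single, Module.End.mul_apply]
  exact congrArg _ (mul_one _)

theorem crossedOp_one_mem (hκ : IsEquivariantForm c) {n : ℕ} {t : TensorCrossed ρ ψ}
    (ht : t ∈ coeffIn (tensorAction ρ) ψ (tensorLE U n)) :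
    crossedOp hκ t 1 ∈ symLower ρ ψ (n + 1) := by
  rw [crossedOp_one_eq_sum]
  exact Submodule.sum_mem _ fun g _ => tensorOp_of_mem g (ht g)

theorem crossedOp_one_sub_mem (hκ : IsEquivariantForm c) {n : ℕ} {t : TensorCrossed ρ ψ}
    (ht : t ∈ coeffIn (tensorAction ρ) ψ (tensorDegree U n)) :
    crossedOp hκ t 1 - symmetrize ρ ψ t ∈ symLower ρ ψ n := by
  rw [crossedOp_one_eq_sum, ← sum_single (symmetrize ρ ψ t), ← Finset.sum_sub_distrib]
  exact Submodule.sum_mem _ fun g _ => tensorOp_of_sub_mem g (ht g)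

/-- The symmetrization of a homogeneous tensor vanishes if the image of the tensor in the
reflection algebra lies in a lower step of the filtration. -/
theorem symmetrize_eq_zero (hω : ω.IsAlt) (hκ : IsEquivariantForm c) {n : ℕ}
    {t : TensorCrossed ρ ψ} (ht : t ∈ coeffIn (tensorAction ρ) ψ (tensorDegree U n))
    (h : toSRA ρ ω ψ c t ∈ (filtration ρ ω ψ c).below n) : symmetrize ρ ψ t = 0 := by
  refine eq_zero_of_mem_symLower (symmetrize_mem ht) ?_
  have h1 : crossedOp hκ t 1 ∈ symLower ρ ψ n := by
    cases n with
    | zero =>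
      have h0 : toSRA ρ ω ψ c t = toSRA ρ ω ψ c 0 := by rw [map_zero]; exact h
      rw [crossedOp_eq_of_toSRA_eq hω hκ h0, map_zero]
      exact zero_mem _
    | succ n =>
      obtain ⟨t', ht', e⟩ := h
      rw [← crossedOp_eq_of_toSRA_eq hω hκ e]
      exact crossedOp_one_mem hκ ht'
  have h2 := sub_mem h1 (crossedOp_one_sub_mem hκ ht)
  rwa [sub_sub_cancel] at h2

end Representation

/-! ### The graded homomorphism -/

section Graded

variable {G : Type u} [Group G] [Fintype G] {U : Type v} [AddCommGroup U] [Module ℂ U]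
  {ρ : Representation ℂ G U} {ω : LinearMap.BilinForm ℂ U} {ψ : TwoCocycle G}
  {c : regularReflections ρ ω ψ → ℂ}

theorem toSRA_mem_of_tensorDegree {n : ℕ} {t : TensorCrossed ρ ψ}
    (ht : t ∈ coeffIn (tensorAction ρ) ψ (tensorDegree U n)) :
    toSRA ρ ω ψ c t ∈ (filtration ρ ω ψ c).F n :=
  toSRA_mem ρ ω ψ c fun g => tensorDegree_le n (ht g)

/-- `φ` sends the symmetrization of a homogeneous tensor to the class of that tensor. -/
theorem pbwMap_single {n : ℕ} (g : G) {a : TensorAlgebra ℂ U} (ha : a ∈ tensorDegree U n) :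
    pbwMap ρ ω ψ c (single (symAction ρ) ψ g (SymmetricAlgebra.algHom ℂ U a))
      = (filtration ρ ω ψ c).grMk n (toSRA ρ ω ψ c (single (tensorAction ρ) ψ g a))
        (toSRA_mem_of_tensorDegree (single_mem g ha)) := by
  have hl : ∀ b, pbwMap ρ ω ψ c (single (symAction ρ) ψ g b)
      = symToGr ρ ω ψ c b * grGrp ρ ω ψ c g := fun b => lift_single _ _ _ _ _ g b
  rw [hl]
  induction ha using Submodule.pow_induction_on_left' with
  | algebraMap r =>
    rw [AlgHom.commutes, AlgHom.commutes, ← Algebra.smul_def, grGrp, ← AlgFiltration.grMk_smul]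
    refine AlgFiltration.grMk_eq _ rfl _ _ ?_
    rw [Algebra.algebraMap_eq_smul_one r, single_smul, map_smul, grp, of, sub_self]
    exact zero_mem _
  | add a b i _ _ ha hb =>
    rw [map_add, map_add, add_mul, ha, hb, ← AlgFiltration.grMk_add]
    refine AlgFiltration.grMk_eq _ rfl _ _ ?_
    rw [single_add, map_add, sub_self]
    exact zero_mem _
  | mem_mul _ hb i a _ ha =>
    obtain ⟨x, rfl⟩ := hb
    have hx : SymmetricAlgebra.algHom ℂ U (TensorAlgebra.ι ℂ x) = SymmetricAlgebra.ι ℂ U x := rfl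
    rw [map_mul, map_mul, mul_assoc, ha, hx, symToGr_ι]
    refine ((filtration ρ ω ψ c).grMk_mul _ _).trans ?_
    refine AlgFiltration.grMk_eq _ (add_comm 1 i) _ _ ?_
    have e : vec ρ ψ x * single (tensorAction ρ) ψ g a
        = single (tensorAction ρ) ψ g (TensorAlgebra.ι ℂ x * a) := by
      classical
      ext h
      rw [vec, base_mul_apply, single_apply, single_apply, mul_ite, mul_zero]
    rw [← map_mul, e, sub_self]
    exact zero_mem _

theorem pbwMap_symmetrize {n : ℕ} {t : TensorCrossed ρ ψ}
    (ht : t ∈ coeffIn (tensorAction ρ) ψ (tensorDegree U n)) :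
    pbwMap ρ ω ψ c (symmetrize ρ ψ t)
      = (filtration ρ ω ψ c).grMk n (toSRA ρ ω ψ c t) (toSRA_mem_of_tensorDegree ht) := by
  have key : ∀ s : Finset G, ∃ h,
      pbwMap ρ ω ψ c (∑ g ∈ s, single (symAction ρ) ψ g (symmetrize ρ ψ t g))
        = (filtration ρ ω ψ c).grMk n
          (toSRA ρ ω ψ c (∑ g ∈ s, single (tensorAction ρ) ψ g (t g))) h := by
    classical
    intro s
    induction s using Finset.induction_on with
    | empty =>
      refine ⟨by simp, ?_⟩
      simp only [Finset.sum_empty, map_zero]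
      exact (map_zero (DirectSum.of (filtration ρ ω ψ c).Piece n)).symm
    | insert g s hg ih =>
      obtain ⟨h, e⟩ := ih
      have hg' := toSRA_mem_of_tensorDegree (c := c) (single_mem g (ht g))
      refine ⟨by rw [Finset.sum_insert hg, map_add]; exact add_mem hg' h, ?_⟩
      rw [Finset.sum_insert hg, map_add, e]
      refine (congrArg (· + _) (pbwMap_single g (ht g))).trans ?_
      rw [← AlgFiltration.grMk_add]
      refine AlgFiltration.grMk_eq _ rfl _ _ ?_
      rw [Finset.sum_insert hg, map_add, sub_self]
      exact zero_mem _
  obtain ⟨h, e⟩ := key Finset.univ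
  rw [sum_single] at e
  rw [e]
  refine AlgFiltration.grMk_eq _ rfl _ _ ?_
  rw [sum_single, sub_self]
  exact zero_mem _

/-- `φ` maps `S^n U ⊗ ℂ_ψ G` onto `F_n / F_{n-1}`. -/
theorem map_symPart (n : ℕ) : (symPart ρ ψ n).map (pbwMap ρ ω ψ c).toLinearMap
    = (filtration ρ ω ψ c).grPart n := by
  refine le_antisymm ?_ ?_
  · rintro _ ⟨m, hm, rfl⟩
    obtain ⟨t, ht, rfl⟩ := exists_symmetrize_eq hm
    rw [AlgHom.toLinearMap_apply, pbwMap_symmetrize ht]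
    exact ⟨_, rfl⟩
  · rintro _ ⟨a, rfl⟩
    obtain ⟨_, ⟨t, ht, rfl⟩, rfl⟩ := (filtration ρ ω ψ c).symb_surj a
    have h : ∃ t' ∈ coeffIn (tensorAction ρ) ψ (tensorDegree U n),
        toSRA ρ ω ψ c t - toSRA ρ ω ψ c t' ∈ (filtration ρ ω ψ c).below n := by
      cases n with
      | zero =>
        refine ⟨t, fun g => ?_, by rw [sub_self]; exact zero_mem _⟩
        have hg := ht g
        rwa [tensorLE, pow_zero, ← pow_zero (LinearMap.range (TensorAlgebra.ι ℂ))] at hg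
      | succ n =>
        have h' : ∃ r ∈ coeffIn (tensorAction ρ) ψ (tensorLE U n),
            ∃ r' ∈ coeffIn (tensorAction ρ) ψ (tensorDegree U (n + 1)), r + r' = t := by
          choose r hr r' hr' e using fun g => Submodule.mem_sup.mp (tensorLE_succ_le n (ht g))
          exact ⟨r, hr, r', hr', funext e⟩
        obtain ⟨r, hr, r', hr', rfl⟩ := h'
        refine ⟨r', hr', r, hr, ?_⟩
        rw [map_add, add_sub_cancel_right]
        rfl
    obtain ⟨t', ht', h⟩ := h
    refine ⟨symmetrize ρ ψ t', symmetrize_mem ht', ?_⟩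
    rw [AlgHom.toLinearMap_apply, pbwMap_symmetrize ht']
    exact (AlgFiltration.grMk_eq _ rfl _ _ h).symm

theorem pbwMap_surjective : Function.Surjective (pbwMap ρ ω ψ c) := fun a => by
  induction a using DirectSum.induction_on with
  | zero => exact ⟨0, map_zero _⟩
  | of n a =>
    have h : DirectSum.lof ℂ ℕ (filtration ρ ω ψ c).Piece n a ∈ (filtration ρ ω ψ c).grPart n :=
      ⟨a, rfl⟩
    rw [← map_symPart] at h
    obtain ⟨m, _, hm⟩ := h
    exact ⟨m, hm⟩
  | add a b ha hb =>
    obtain ⟨m, rfl⟩ := ha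
    obtain ⟨m', rfl⟩ := hb
    exact ⟨m + m', map_add _ m m'⟩

/-- Injectivity of `φ` on homogeneous elements. -/
theorem eq_zero_of_pbwMap_eq_zero_of_mem (hω : ω.IsAlt) (hκ : IsEquivariantForm c) {n : ℕ}
    {m : SymCrossed ρ ψ} (hm : m ∈ symPart ρ ψ n) (h : pbwMap ρ ω ψ c m = 0) : m = 0 := by
  obtain ⟨t, ht, rfl⟩ := exists_symmetrize_eq hm
  rw [pbwMap_symmetrize ht] at h
  refine symmetrize_eq_zero hω hκ ht ?_
  have h' : (filtration ρ ω ψ c).symb n (toSRA ρ ω ψ c t) (toSRA_mem_of_tensorDegree ht)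
      = (filtration ρ ω ψ c).symb n 0 (zero_mem _) :=
    DirectSum.of_injective (β := (filtration ρ ω ψ c).Piece) n
      (h.trans (map_zero (DirectSum.of (filtration ρ ω ψ c).Piece n)).symm)
  rw [AlgFiltration.symb_eq, sub_zero] at h'
  exact h'

theorem pbwMap_injective (hω : ω.IsAlt) (hκ : IsEquivariantForm c) :
    Function.Injective (pbwMap ρ ω ψ c) := by
  refine (injective_iff_map_eq_zero _).mpr fun m hm => ?_
  obtain ⟨f, hf, rfl⟩ := (Submodule.mem_iSup_iff_exists_finsupp _ _).mp (mem_iSup_symPart m)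
  have h1 : ∀ i, ∃ b, DirectSum.lof ℂ ℕ (filtration ρ ω ψ c).Piece i b
      = pbwMap ρ ω ψ c (f i) := fun i => by
    have h : pbwMap ρ ω ψ c (f i) ∈ (filtration ρ ω ψ c).grPart i := by
      rw [← map_symPart]
      exact ⟨f i, hf i, rfl⟩
    exact h
  choose b hb using h1
  have h2 : ∀ j ∈ f.support, b j = 0 := fun j hj => by
    have h := congrArg (DirectSum.component ℂ ℕ (filtration ρ ω ψ c).Piece j) hm
    rw [Finsupp.sum, map_sum, map_sum, Finset.sum_eq_single j, ← hb, map_zero] at h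
    · rwa [DirectSum.component.lof_self] at h
    · intro i _ hij
      rw [← hb, DirectSum.component.of, dif_neg hij]
    · exact fun h => absurd hj h
  refine Finset.sum_eq_zero fun j hj => ?_
  refine eq_zero_of_pbwMap_eq_zero_of_mem hω hκ (hf j) ?_
  rw [← hb, h2 j hj, map_zero]

end Graded
end TwistedSRA
end

theorem mainTheorem3 {G : Type u} [Group G] [Fintype G]
    {U : Type v} [AddCommGroup U] [Module ℂ U]
    (ω : LinearMap.BilinForm ℂ U) (hω_alt : ω.IsAlt) (hω_nondeg : ω.Nondegenerate)
    (ρ : Representation ℂ G U) (hρ : ∀ (g : G) (x y : U), ω (ρ g x) (ρ g y) = ω x y)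
    (ψ : TwistedSRA.TwoCocycle G) (hψ : ψ.IsClassFunction)
    (c : TwistedSRA.regularReflections ρ ω ψ → ℂ)
    (hc : ∀ (g : G) (s t : TwistedSRA.regularReflections ρ ω ψ),
      (t : G) = g * (s : G) * g⁻¹ → c t = c s) :
    Function.Bijective (TwistedSRA.pbwMap ρ ω ψ c) ∧
      ∀ n : ℕ, (TwistedSRA.symPart ρ ψ n).map (TwistedSRA.pbwMap ρ ω ψ c).toLinearMap
        = (TwistedSRA.filtration ρ ω ψ c).grPart n :=
  ⟨⟨TwistedSRA.pbwMap_injective hω_alt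
      (TwistedSRA.of_mul_kappa (TwistedSRA.symAction ρ) hρ hψ hc),
    TwistedSRA.pbwMap_surjective⟩, TwistedSRA.map_symPart⟩
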